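/- **Setting.** Let $K$ be a simplicial complex with $K_n$ its set of $n$-simplices (each with a chosen orientation), such that for some finite $N,L$ one has $K_n=\emptyset$ for $n>N$ and every $x\in K_n$ is a face of at most $L$ simplices of $K_{n+1}$. Let $C_n$ be the free abelian group on $K_n$, with boundary $\partial x=\sum_{y}\epsilon_{x,y}\,y$ and coboundary $\widehat\partial x=\sum_z\epsilon_{z,x}\,z$, where $\epsilon$ are the incidence numbers. Let $(G_\bullet,\partial^G_\bullet)$, $\partial^G_j:G_j\to G_{j-1}$, be a chain complex of finite abelian groups with $G_j=0$ for $j<0$ and for $j>N$; let $\widehat G_j$ be the (additively written) character group of $G_j$ and $\widehat\partial^G_{j}:\widehat G_{j-1}\to\widehat G_{j}$, $\alpha\mapsto\alpha\circ\partial^G_j$. For $p\in\mathbb Z$ let $\mathrm{Hom}_0(C,G)^p$ be the group of families $t=(t_n)$ of homomorphisms $t_n:C_n\to G_{n-p}$ such that, for each $n$, $t_n(x)\ne 0$ for only finitely many $x\in K_n$; let $\mathrm{Hom}_0(C,G)_p$ be the group of families $\gamma=(\gamma_n)$ of homomorphisms $\gamma_n:C_n\to\widehat G_{n-p}$ with the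 same finiteness property. Put $$(\delta^p t)_n=t_{n-1}\circ\partial_n-(-1)^p\,\partial^G_{n-p}\circ t_n,\qquad (\delta_p\gamma)_n=\gamma_{n+1}\circ\widehat\partial_{n+1}-(-1)^{p-1}\,\widehat\partial^G_{n+1-p}\circ\gamma_n ,$$ so that $\delta^p:\mathrm{Hom}_0(C,G)^p\to\mathrm{Hom}_0(C,G)^{p+1}$ and $\delta_p:\mathrm{Hom}_0(C,G)_p\to\mathrm{Hom}_0(C,G)_{p-1}$. To $x\in K_n$ attach the Hilbert space $\mathfrak h_x=L^2(G_n)$ with orthonormal basis $|g\rangle$, $g\in G_n$. Let $\mathfrak A_\Lambda=\mathcal B(\bigotimes_{x\in\Lambda}\mathfrak h_x)$ for finite $\Lambda\subset K$, and let $\mathfrak A$ be the quasi-local $C^*$-algebra, i.e. the norm completion of $\bigcup_\Lambda\mathfrak A_\Lambda$ under the inclusions $A\mapsto A\otimes 1$. For $t\in\mathrm{Hom}_0(C,G)^0$ and $\gamma\in\mathrm{Hom}_0(C,G)_0$ let $P_t,Q_\gamma\in\mathfrak A$ be the local unitaries acting on configurations $h=(h_x)_x$ by $$P_t|h\rangle=|t+h\rangle,\qquad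 Q_\gamma|h\rangle=\Big(\prod_x\gamma(x)(h_x)\Big)|h\rangle .$$ Set $A_t=P_{\delta^{-1}t}$ for $t\in\mathrm{Hom}_0(C,G)^{-1}$ and $B_\gamma=Q_{\delta_1\gamma}$ for $\gamma\in\mathrm{Hom}_0(C,G)_1$, and let the core algebra $\mathfrak K\subset\mathfrak A$ be the $C^*$-subalgebra generated by all the $A_t$ and $B_\gamma$. **Lemma (Seed state).** The $C^*$-algebra $\mathfrak K$ is abelian, and there is exactly one state $\vartheta$ on $\mathfrak K$ (positive linear functional with $\vartheta(1)=1$) such that $$\vartheta(A_tB_\gamma)=1\qquad\text{for all }t\in\mathrm{Hom}_0(C,G)^{-1},\ \gamma\in\mathrm{Hom}_0(C,G)_1 .$$ This state is multiplicative, $\vartheta(ab)=\vartheta(a)\vartheta(b)$ for all $a,b\in\mathfrak K$, and it is pure, i.e. an extreme point of the state space of $\mathfrak K$. -/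

import Mathlib

open scoped ComplexOrder

universe u w

noncomputable section

namespace HigherQDM

/-! ## Local observables and the quasi-local algebra of a spin system

`ι` is the set of sites, the Hilbert space at the site `i` is `L²(G i)` for a finite abelian group
`G i`, with orthonormal basis `|g⟩`, `g ∈ G i`. -/

section SpinSystem

variable {ι : Type u} (G : ι → Type w) [∀ i, AddCommGroup (G i)]

/-- Finitely supported configurations. -/
abbrev Conf : Type (max u w) := Π₀ i, G i

/-- The Hilbert space with orthonormal basis `|h⟩` indexed by the finitely supported configurations
`h`, i.e. the (incomplete) infinite tensor product of the `L²(G i)` along the reference vectors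
`|0⟩`. It carries all local observables (see `localEmbed`). -/
abbrev ConfSpace : Type (max u w) := lp (fun _ : Conf G => ℂ) 2

variable {G}

theorem ConfSpace.norm_sq (v : ConfSpace G) :
    HasSum (fun h => ‖v h‖ ^ (2 : ℝ)) (‖v‖ ^ (2 : ℝ)) := by
  simpa using lp.hasSum_norm (p := 2) (by norm_num) v

/-- Multiplication by a bounded function `f`: `|h⟩ ↦ f(h) |h⟩`. -/
def mulOp (f : Conf G → ℂ) (C : ℝ) (hf : ∀ h, ‖f h‖ ≤ C) : ConfSpace G →L[ℂ] ConfSpace G :=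
  have hC : 0 ≤ C := (norm_nonneg _).trans (hf 0)
  have key : ∀ (v : ConfSpace G) (h : Conf G),
      ‖f h * v h‖ ^ (2 : ℝ) ≤ C ^ (2 : ℝ) * ‖v h‖ ^ (2 : ℝ) := fun v h => by
    rw [← Real.mul_rpow hC (norm_nonneg _), norm_mul]
    gcongr
    exact hf h
  have mem : ∀ v : ConfSpace G, Memℓp (fun h => f h * v h) 2 := fun v =>
    memℓp_gen (Summable.of_nonneg_of_le (fun _ => by positivity)
      (fun h => by simpa using key v h) ((ConfSpace.norm_sq v).summable.mul_left (C ^ (2 : ℝ))))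
  LinearMap.mkContinuous
    { toFun := fun v => ⟨fun h => f h * v h, mem v⟩
      map_add' := fun v w => lp.ext (funext fun h => mul_add (f h) (v h) (w h))
      map_smul' := fun c v => lp.ext (funext fun h => mul_left_comm (f h) c (v h)) } C
    (fun v => by
      refine lp.norm_le_of_tsum_le (by norm_num) (by positivity) ?_
      have h1 := (ConfSpace.norm_sq v).mul_left (C ^ (2 : ℝ))
      rw [Real.mul_rpow hC (norm_nonneg _)]
      simp only [ENNReal.toReal_ofNat]
      rw [← h1.tsum_eq]
      exact Summable.tsum_le_tsum (key v)
        (Summable.of_nonneg_of_le (fun _ => by positivity) (key v) h1.summable) h1.summable)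

@[simp]
theorem mulOp_apply (f : Conf G → ℂ) (C : ℝ) (hf : ∀ h, ‖f h‖ ≤ C) (v : ConfSpace G) (h : Conf G) :
    mulOp f C hf v h = f h * v h := rfl

/-- The shift by `g`: `|h⟩ ↦ |g + h⟩`, i.e. `(shiftOp g v)(h) = v(h - g)`. -/
def shiftOp (g : Conf G) : ConfSpace G →L[ℂ] ConfSpace G :=
  have key : ∀ v : ConfSpace G,
      HasSum (fun h => ‖v (h - g)‖ ^ (2 : ℝ)) (‖v‖ ^ (2 : ℝ)) := fun v =>
    (Equiv.subRight g).hasSum_iff.mpr (ConfSpace.norm_sq v)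
  have mem : ∀ v : ConfSpace G, Memℓp (fun h => v (h - g)) 2 := fun v =>
    memℓp_gen (by simpa using (key v).summable)
  LinearMap.mkContinuous
    { toFun := fun v => ⟨fun h => v (h - g), mem v⟩
      map_add' := fun _ _ => rfl
      map_smul' := fun _ _ => rfl } 1
    (fun v => by
      refine lp.norm_le_of_tsum_le (by norm_num) (by positivity) ?_
      simp only [ENNReal.toReal_ofNat, one_mul]
      exact (key v).tsum_eq.le)

@[simp]
theorem shiftOp_apply (g : Conf G) (v : ConfSpace G) (h : Conf G) :
    shiftOp g v h = v (h - g) := rfl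

theorem ConfSpace.ext_op {A B : ConfSpace G →L[ℂ] ConfSpace G}
    (H : ∀ v h, A v h = B v h) : A = B :=
  ContinuousLinearMap.ext fun v => lp.ext (funext (H v))

theorem sum_op_apply {κ : Type*} (s : Finset κ) (T : κ → ConfSpace G →L[ℂ] ConfSpace G)
    (v : ConfSpace G) (h : Conf G) : (∑ k ∈ s, T k) v h = ∑ k ∈ s, T k v h := by
  rw [sum_apply, lp.coeFn_sum, Finset.sum_apply]

theorem mul_op_apply (A B : ConfSpace G →L[ℂ] ConfSpace G) (v : ConfSpace G) (h : Conf G) :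
    (A * B) v h = A (B v) h := rfl

theorem star_mulOp (f : Conf G → ℂ) (C : ℝ) (hf : ∀ h, ‖f h‖ ≤ C) :
    star (mulOp f C hf) = mulOp (fun h => star (f h)) C (fun h => by simpa using hf h) := by
  rw [ContinuousLinearMap.star_eq_adjoint]
  symm
  rw [ContinuousLinearMap.eq_adjoint_iff]
  intro v w
  simp only [lp.inner_eq_tsum]
  refine tsum_congr fun h => ?_
  simp [mul_comm, mul_left_comm, mul_assoc]

theorem star_shiftOp (g : Conf G) : star (shiftOp g) = shiftOp (-g) := by
  rw [ContinuousLinearMap.star_eq_adjoint]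
  symm
  rw [ContinuousLinearMap.eq_adjoint_iff]
  intro v w
  simp only [lp.inner_eq_tsum]
  rw [← (Equiv.subRight g).tsum_eq]
  refine tsum_congr fun h => ?_
  simp

/-- The site-wise character `h ↦ ∏ i, α i (h i)` of the group of finitely supported
configurations. -/
def charValue (α : ∀ i, AddChar (G i) Circle) (h : Conf G) : Circle := ∏ᶠ i, α i (h i)

/-- The clock operator `|h⟩ ↦ (∏ i, α i (h i)) |h⟩`. -/
def clockOp (α : Π₀ i, AddChar (G i) Circle) : ConfSpace G →L[ℂ] ConfSpace G :=
  mulOp (fun h => (charValue (fun i => α i) h : ℂ)) 1 (fun _ => (Circle.norm_coe _).le)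

variable (G)

/-- Configurations on a finite set `Λ` of sites; they index the canonical basis of
`⨂ i ∈ Λ, L²(G i)`. -/
def LocConf (Λ : Finset ι) : Type (max u w) := ∀ i : (↑Λ : Set ι), G i

instance (Λ : Finset ι) : AddCommGroup (LocConf G Λ) :=
  inferInstanceAs (AddCommGroup (∀ i : (↑Λ : Set ι), G i))

instance [∀ i, Finite (G i)] (Λ : Finset ι) : Fintype (LocConf G Λ) :=
  @Fintype.ofFinite _ (inferInstanceAs (Finite (∀ i : (↑Λ : Set ι), G i)))

instance (Λ : Finset ι) : DecidableEq (LocConf G Λ) := Classical.decEq _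

variable {G}

/-- Restriction of a configuration to `Λ`. -/
def res (Λ : Finset ι) (h : Conf G) : LocConf G Λ := fun i => h i

open scoped Classical in
/-- Extension by zero of a configuration on `Λ`. -/
def ext0 (Λ : Finset ι) (k : LocConf G Λ) : Conf G := DFinsupp.mk Λ k

/-- Replace the values of `h` on `Λ` by those of `k`. -/
def splice (Λ : Finset ι) (h : Conf G) (k : LocConf G Λ) : Conf G := h + ext0 Λ (k - res Λ h)

theorem ext0_of_mem {Λ : Finset ι} (k : LocConf G Λ) {i : ι} (hi : i ∈ Λ) :
    ext0 Λ k i = k ⟨i, hi⟩ := by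
  classical
  exact DFinsupp.mk_of_mem hi

theorem ext0_of_notMem {Λ : Finset ι} (k : LocConf G Λ) {i : ι} (hi : i ∉ Λ) :
    ext0 Λ k i = 0 := by
  classical
  exact DFinsupp.mk_of_notMem hi

theorem splice_of_mem {Λ : Finset ι} (h : Conf G) (k : LocConf G Λ) {i : ι} (hi : i ∈ Λ) :
    splice Λ h k i = k ⟨i, hi⟩ := by
  rw [splice, DFinsupp.add_apply, ext0_of_mem _ hi]
  exact add_sub_cancel (h i) (k ⟨i, hi⟩)

theorem splice_of_notMem {Λ : Finset ι} (h : Conf G) (k : LocConf G Λ) {i : ι} (hi : i ∉ Λ) :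
    splice Λ h k i = h i := by
  rw [splice, DFinsupp.add_apply, ext0_of_notMem _ hi, add_zero]

theorem res_splice (Λ : Finset ι) (h : Conf G) (k : LocConf G Λ) : res Λ (splice Λ h k) = k :=
  funext fun i => splice_of_mem h k i.2

theorem splice_splice (Λ : Finset ι) (h : Conf G) (k l : LocConf G Λ) :
    splice Λ (splice Λ h k) l = splice Λ h l := by
  ext i
  by_cases hi : i ∈ Λ
  · rw [splice_of_mem _ _ hi, splice_of_mem _ _ hi]
  · rw [splice_of_notMem _ _ hi, splice_of_notMem _ _ hi, splice_of_notMem _ _ hi]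

theorem splice_res (Λ : Finset ι) (h : Conf G) : splice Λ h (res Λ h) = h := by
  ext i
  by_cases hi : i ∈ Λ
  · rw [splice_of_mem _ _ hi, res]
  · rw [splice_of_notMem _ _ hi]

theorem res_add (Λ : Finset ι) (h k : Conf G) : res Λ (h + k) = res Λ h + res Λ k := rfl

theorem res_ext0 (Λ : Finset ι) (k : LocConf G Λ) : res Λ (ext0 Λ k) = k :=
  funext fun i => ext0_of_mem k i.2

theorem ext0_neg (Λ : Finset ι) (k : LocConf G Λ) : ext0 Λ (-k) = -ext0 Λ k := by
  classical
  exact DFinsupp.mk_neg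

variable [∀ i, Finite (G i)]

/-- The operator `a ⊗ 1` on `ConfSpace G`, for a matrix `a` acting on the sites in `Λ`. -/
def matOp (Λ : Finset ι) (a : Matrix (LocConf G Λ) (LocConf G Λ) ℂ) :
    ConfSpace G →L[ℂ] ConfSpace G :=
  ∑ d : LocConf G Λ,
    mulOp (fun h => a (res Λ h) (res Λ h + d)) (∑ k, ∑ l, ‖a k l‖)
      (fun h => (Finset.single_le_sum (f := fun l => ‖a (res Λ h) l‖)
          (fun _ _ => norm_nonneg _) (Finset.mem_univ (res Λ h + d))).trans
        (Finset.single_le_sum (f := fun k => ∑ l, ‖a k l‖)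
          (fun _ _ => Finset.sum_nonneg fun _ _ => norm_nonneg _) (Finset.mem_univ (res Λ h)))) *
    shiftOp (-ext0 Λ d)

theorem matOp_apply' (Λ : Finset ι) (a : Matrix (LocConf G Λ) (LocConf G Λ) ℂ)
    (v : ConfSpace G) (h : Conf G) :
    matOp Λ a v h = ∑ d, a (res Λ h) (res Λ h + d) * v (h + ext0 Λ d) := by
  rw [matOp, sum_op_apply]
  refine Finset.sum_congr rfl fun d _ => ?_
  rw [mul_op_apply, mulOp_apply, shiftOp_apply, sub_neg_eq_add]

/-- `matOp Λ a` acts as the matrix `a` on the sites of `Λ` and as the identity on the others. -/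
theorem matOp_apply (Λ : Finset ι) (a : Matrix (LocConf G Λ) (LocConf G Λ) ℂ)
    (v : ConfSpace G) (h : Conf G) :
    matOp Λ a v h = ∑ k, a (res Λ h) k * v (splice Λ h k) := by
  rw [matOp_apply']
  refine Fintype.sum_equiv (Equiv.addLeft (res Λ h)) _ _ fun d => ?_
  simp [splice]

theorem matOp_one (Λ : Finset ι) :
    matOp Λ (1 : Matrix (LocConf G Λ) (LocConf G Λ) ℂ) = 1 := by
  refine ConfSpace.ext_op fun v h => ?_
  simp [matOp_apply, Matrix.one_apply, splice_res]

theorem matOp_mul (Λ : Finset ι) (a b : Matrix (LocConf G Λ) (LocConf G Λ) ℂ) :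
    matOp Λ (a * b) = matOp Λ a * matOp Λ b := by
  refine ConfSpace.ext_op fun v h => ?_
  simp only [mul_op_apply, matOp_apply, res_splice, splice_splice,
    Matrix.mul_apply, Finset.sum_mul, Finset.mul_sum]
  rw [Finset.sum_comm]
  simp only [mul_assoc]

theorem matOp_add (Λ : Finset ι) (a b : Matrix (LocConf G Λ) (LocConf G Λ) ℂ) :
    matOp Λ (a + b) = matOp Λ a + matOp Λ b := by
  refine ConfSpace.ext_op fun v h => ?_
  simp [matOp_apply, add_mul, Finset.sum_add_distrib]

theorem matOp_smul (Λ : Finset ι) (c : ℂ) (a : Matrix (LocConf G Λ) (LocConf G Λ) ℂ) :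
    matOp Λ (c • a) = c • matOp Λ a := by
  refine ConfSpace.ext_op fun v h => ?_
  simp [matOp_apply, mul_assoc, Finset.mul_sum]

theorem matOp_star (Λ : Finset ι) (a : Matrix (LocConf G Λ) (LocConf G Λ) ℂ) :
    matOp Λ (star a) = star (matOp Λ a) := by
  refine ConfSpace.ext_op fun v h => ?_
  rw [matOp_apply']
  conv_rhs => rw [matOp, star_sum, sum_op_apply]
  simp only [star_mul, star_mulOp, star_shiftOp, neg_neg, mul_op_apply, shiftOp_apply, mulOp_apply]
  refine Fintype.sum_equiv (Equiv.neg _) _ _ fun d => ?_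
  have e : res Λ (h - ext0 Λ (-d)) = res Λ h + d := by
    rw [ext0_neg, sub_neg_eq_add, res_add, res_ext0]
  simp only [Equiv.neg_apply, e, Matrix.star_apply]
  rw [ext0_neg, sub_neg_eq_add, add_neg_cancel_right]

/-- `𝔥_Λ = ⨂ i ∈ Λ, L²(G i)`, written as the Hilbert space with orthonormal basis the
configurations on `Λ`. -/
abbrev LocSpace (G : ι → Type w) [∀ i, AddCommGroup (G i)] [∀ i, Finite (G i)] (Λ : Finset ι) :
    Type (max u w) :=
  EuclideanSpace ℂ (LocConf G Λ)

/-- The embedding `A ↦ A ⊗ 1` of the algebra `𝔄_Λ = B(𝔥_Λ)`. It is an injective (hence isometric)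
star homomorphism, compatible with the inclusions `𝔄_Λ₁ ⊆ 𝔄_Λ₂`; see `localEmbed_injective` and
`matOp_mono`. -/
def localEmbed (Λ : Finset ι) :
    (LocSpace G Λ →L[ℂ] LocSpace G Λ) →⋆ₐ[ℂ] (ConfSpace G →L[ℂ] ConfSpace G) :=
  StarAlgHom.comp
    { toFun := matOp Λ
      map_one' := matOp_one Λ
      map_mul' := matOp_mul Λ
      map_zero' := by simpa using matOp_smul Λ 0 (0 : Matrix (LocConf G Λ) (LocConf G Λ) ℂ)
      map_add' := matOp_add Λ
      commutes' := fun c => by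
        rw [Algebra.algebraMap_eq_smul_one, matOp_smul, matOp_one, Algebra.algebraMap_eq_smul_one]
      map_star' := matOp_star Λ }
    (Matrix.toEuclideanCLM (n := LocConf G Λ) (𝕜 := ℂ)).symm.toStarAlgHom

theorem mem_range_localEmbed {Λ : Finset ι} {A : ConfSpace G →L[ℂ] ConfSpace G} :
    A ∈ (localEmbed (G := G) Λ).range ↔ ∃ a, matOp Λ a = A := by
  constructor
  · rintro ⟨T, rfl⟩
    exact ⟨_, rfl⟩
  · rintro ⟨a, rfl⟩
    refine ⟨Matrix.toEuclideanCLM (n := LocConf G Λ) (𝕜 := ℂ) a, ?_⟩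
    exact congrArg (matOp Λ)
      ((Matrix.toEuclideanCLM (n := LocConf G Λ) (𝕜 := ℂ)).symm_apply_apply a)

theorem matOp_injective (Λ : Finset ι) : Function.Injective (matOp (G := G) Λ) := by
  classical
  intro a b hab
  ext k l
  have h1 := congrArg (fun A : ConfSpace G →L[ℂ] ConfSpace G =>
    A (lp.single 2 (ext0 Λ l) (1 : ℂ)) (ext0 Λ k)) hab
  have h2 : ∀ m : LocConf G Λ, splice Λ (ext0 Λ k) m = ext0 Λ m := fun m => by
    ext i
    by_cases hi : i ∈ Λ
    · rw [splice_of_mem _ _ hi, ext0_of_mem _ hi]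
    · rw [splice_of_notMem _ _ hi, ext0_of_notMem _ hi, ext0_of_notMem _ hi]
  have h3 : ∀ m : LocConf G Λ, ext0 Λ m = ext0 Λ l ↔ m = l := fun m =>
    ⟨fun h => by rw [← res_ext0 Λ m, h, res_ext0], fun h => h ▸ rfl⟩
  simpa [matOp_apply, res_ext0, h2, lp.single_apply, Pi.single_apply, h3] using h1

theorem localEmbed_injective (Λ : Finset ι) : Function.Injective (localEmbed (G := G) Λ) :=
  (matOp_injective Λ).comp (Matrix.toEuclideanCLM (n := LocConf G Λ) (𝕜 := ℂ)).symm.injective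

/-- Restriction of configurations from `Λ₂` to a smaller set `Λ₁`. -/
def locRes {Λ₁ Λ₂ : Finset ι} (hΛ : Λ₁ ⊆ Λ₂) (k : LocConf G Λ₂) : LocConf G Λ₁ :=
  fun i => k ⟨i, hΛ i.2⟩

open scoped Classical in
/-- The matrix of `A ⊗ 1` in `𝔄_Λ₂`, for `A` in `𝔄_Λ₁` with matrix `a`. -/
def matIncl {Λ₁ Λ₂ : Finset ι} (hΛ : Λ₁ ⊆ Λ₂) (a : Matrix (LocConf G Λ₁) (LocConf G Λ₁) ℂ) :
    Matrix (LocConf G Λ₂) (LocConf G Λ₂) ℂ :=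
  fun h k => if ∀ i : (↑Λ₂ : Set ι), i.1 ∉ Λ₁ → h i = k i then
    a (locRes hΛ h) (locRes hΛ k) else 0

theorem matOp_mono {Λ₁ Λ₂ : Finset ι} (hΛ : Λ₁ ⊆ Λ₂)
    (a : Matrix (LocConf G Λ₁) (LocConf G Λ₁) ℂ) : matOp Λ₂ (matIncl hΛ a) = matOp Λ₁ a := by
  classical
  refine ConfSpace.ext_op fun v h => ?_
  rw [matOp_apply, matOp_apply]
  symm
  refine Finset.sum_of_injOn (fun k => res Λ₂ (splice Λ₁ h k)) ?_ (by simp) ?_ ?_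
  · intro k _ l _ hkl
    have := congrArg (locRes hΛ) hkl
    have e : ∀ k : LocConf G Λ₁, locRes hΛ (res Λ₂ (splice Λ₁ h k)) = k := fun k =>
      res_splice Λ₁ h k
    rwa [e, e] at this
  · intro k _ hk
    rw [matIncl, if_neg, zero_mul]
    intro H
    refine hk ⟨locRes hΛ k, by simp, ?_⟩
    funext i
    by_cases hi : i.1 ∈ Λ₁
    · exact splice_of_mem h _ hi
    · exact (splice_of_notMem h _ hi).trans (H i hi)
  · intro k _
    have e1 : locRes hΛ (res Λ₂ h) = res Λ₁ h := rfl
    have e2 : locRes hΛ (res Λ₂ (splice Λ₁ h k)) = k := res_splice Λ₁ h k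
    have e3 : splice Λ₂ h (res Λ₂ (splice Λ₁ h k)) = splice Λ₁ h k := by
      ext i
      by_cases hi : i ∈ Λ₂
      · rw [splice_of_mem _ _ hi, res]
      · rw [splice_of_notMem _ _ hi, splice_of_notMem _ _ fun h' => hi (hΛ h')]
    simp only [matIncl]
    rw [if_pos, e1, e2, e3]
    exact fun i hi => (splice_of_notMem h _ hi).symm

theorem localEmbed_range_mono {Λ₁ Λ₂ : Finset ι} (hΛ : Λ₁ ⊆ Λ₂) :
    (localEmbed (G := G) Λ₁).range ≤ (localEmbed (G := G) Λ₂).range := by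
  intro A hA
  obtain ⟨a, rfl⟩ := mem_range_localEmbed.mp hA
  exact mem_range_localEmbed.mpr ⟨_, matOp_mono hΛ a⟩

variable (G)

theorem exists_common_range {A B : ConfSpace G →L[ℂ] ConfSpace G}
    (hA : A ∈ ⋃ Λ : Finset ι, ((localEmbed (G := G) Λ).range :
      Set (ConfSpace G →L[ℂ] ConfSpace G)))
    (hB : B ∈ ⋃ Λ : Finset ι, ((localEmbed (G := G) Λ).range :
      Set (ConfSpace G →L[ℂ] ConfSpace G))) :
    ∃ Λ : Finset ι, A ∈ (localEmbed (G := G) Λ).range ∧ B ∈ (localEmbed (G := G) Λ).range := by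
  classical
  obtain ⟨Λ, hA⟩ := Set.mem_iUnion.mp hA
  obtain ⟨Λ', hB⟩ := Set.mem_iUnion.mp hB
  exact ⟨Λ ∪ Λ', localEmbed_range_mono Finset.subset_union_left hA,
    localEmbed_range_mono Finset.subset_union_right hB⟩

/-- The local algebra `𝔄_loc = ⋃_Λ 𝔄_Λ`. -/
def localAlgebra : StarSubalgebra ℂ (ConfSpace G →L[ℂ] ConfSpace G) where
  carrier := ⋃ Λ : Finset ι, ((localEmbed (G := G) Λ).range :
      Set (ConfSpace G →L[ℂ] ConfSpace G))
  mul_mem' hA hB :=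
    have ⟨Λ, h1, h2⟩ := exists_common_range G hA hB
    Set.mem_iUnion.mpr ⟨Λ, mul_mem h1 h2⟩
  add_mem' hA hB :=
    have ⟨Λ, h1, h2⟩ := exists_common_range G hA hB
    Set.mem_iUnion.mpr ⟨Λ, add_mem h1 h2⟩
  algebraMap_mem' c := Set.mem_iUnion.mpr ⟨∅, algebraMap_mem _ c⟩
  star_mem' hA :=
    have ⟨Λ, h1⟩ := Set.mem_iUnion.mp hA
    Set.mem_iUnion.mpr ⟨Λ, star_mem h1⟩

/-- The quasi-local algebra `𝔄`, the norm closure of `𝔄_loc`. -/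
def quasiLocal : StarSubalgebra ℂ (ConfSpace G →L[ℂ] ConfSpace G) :=
  (localAlgebra G).topologicalClosure

variable {G}

theorem mem_localAlgebra {A : ConfSpace G →L[ℂ] ConfSpace G} (Λ : Finset ι)
    (a : Matrix (LocConf G Λ) (LocConf G Λ) ℂ) (H : matOp Λ a = A) : A ∈ localAlgebra G :=
  Set.mem_iUnion.mpr ⟨Λ, mem_range_localEmbed.mpr ⟨a, H⟩⟩

theorem shiftOp_mem (g : Conf G) : shiftOp g ∈ quasiLocal G := by
  classical
  refine StarSubalgebra.le_topologicalClosure _ (mem_localAlgebra g.support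
    (Matrix.of fun h k => if k = h - res g.support g then 1 else 0) ?_)
  refine ConfSpace.ext_op fun v h => ?_
  have e : splice g.support h (res g.support h - res g.support g) = h - g := by
    ext i
    by_cases hi : i ∈ g.support
    · rw [splice_of_mem _ _ hi]; rfl
    · rw [splice_of_notMem _ _ hi, DFinsupp.sub_apply, DFinsupp.notMem_support_iff.mp hi, sub_zero]
  rw [matOp_apply, Finset.sum_eq_single (res g.support h - res g.support g)]
  · rw [Matrix.of_apply, if_pos rfl, one_mul, e, shiftOp_apply]
  · intro k _ hk
    rw [Matrix.of_apply, if_neg hk, zero_mul]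
  · simp

theorem clockOp_mem (α : Π₀ i, AddChar (G i) Circle) : clockOp α ∈ quasiLocal G := by
  classical
  refine StarSubalgebra.le_topologicalClosure _ (mem_localAlgebra α.support
    (Matrix.of fun h k => if k = h then (charValue (fun i => α i) (ext0 _ h) : ℂ) else 0) ?_)
  refine ConfSpace.ext_op fun v h => ?_
  have e : charValue (fun i => α i) (ext0 α.support (res α.support h))
      = charValue (fun i => α i) h := by
    refine finprod_congr fun i => ?_
    by_cases hi : i ∈ α.support
    · rw [ext0_of_mem _ hi, res]
    · have h0 : α i = 0 := DFinsupp.notMem_support_iff.mp hi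
      simp [h0]
  rw [matOp_apply, Finset.sum_eq_single (res α.support h)]
  · rw [Matrix.of_apply, if_pos rfl, splice_res, e, clockOp, mulOp_apply]
  · intro k _ hk
    rw [Matrix.of_apply, if_neg hk, zero_mul]
  · simp

end SpinSystem

/-! ## Geometric and algebraic data -/

/-- A simplicial complex on the vertex set `V`, of dimension at most `dim` and `reg`-regular, with a
choice of orientation of each simplex. The linear order on `V` is a reference: `orient x = 1` means
that `x = {v₀ < ⋯ < vₙ}` carries the orientation `[v₀, …, vₙ]`, and `orient x = -1` that it carries
the opposite one. -/
structure GeometricData (V : Type u) [LinearOrder V] where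
  complex : AbstractSimplicialComplex V
  dim : ℕ
  reg : ℕ
  card_le : ∀ x ∈ complex, x.card ≤ dim + 1
  regular : ∀ x ∈ complex, {z | z ∈ complex ∧ x ⊆ z ∧ z.card = x.card + 1}.encard ≤ reg
  orient : Finset V → ℤˣ
  orient_vertex : ∀ v, orient {v} = 1

section Complex

variable {V : Type u} [LinearOrder V] (K : GeometricData V)

/-- The `n`-simplices (none if `n < 0`). -/
def Simplex (n : ℤ) : Type u := {x : Finset V // x ∈ K.complex ∧ (x.card : ℤ) = n + 1}

/-- All simplices, sorted by their dimension. -/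
abbrev Site : Type u := Σ n : ℤ, Simplex K n

/-- The free abelian group on the `n`-simplices. -/
abbrev Chain (n : ℤ) : Type u := Simplex K n →₀ ℤ

/-- The incidence number of `x` and `y`: if `y` is obtained from `x` by removing its `i`-th vertex
(in increasing order, from `i = 0`), it is `(-1)^i`, corrected by the orientations of `x`
and `y`; otherwise it is `0`. -/
def incidence (x y : Finset V) : ℤ :=
  ∑ v ∈ x, if x.erase v = y then
    ((K.orient x * K.orient y : ℤˣ) : ℤ) * (-1) ^ (x.filter (· < v)).card else 0

variable {K}

theorem incidence_ne_zero {x y : Finset V} (h : incidence K x y ≠ 0) :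
    ∃ v ∈ x, x.erase v = y := by
  obtain ⟨v, hv, h'⟩ := Finset.exists_ne_zero_of_sum_ne_zero h
  exact ⟨v, hv, by by_contra H; simp [H] at h'⟩

theorem finite_faces {m : ℤ} (x : Finset V) :
    {y : Simplex K m | incidence K x y.1 ≠ 0}.Finite := by
  refine Set.Finite.of_finite_image (f := Subtype.val) ?_ Subtype.val_injective.injOn
  refine (x.powerset.finite_toSet).subset ?_
  rintro _ ⟨y, hy, rfl⟩
  obtain ⟨v, _, h⟩ := incidence_ne_zero hy
  simp [← h]

theorem finite_cofaces {n m : ℤ} (y : Simplex K n) :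
    {z : Simplex K m | incidence K z.1 y.1 ≠ 0}.Finite := by
  refine Set.Finite.of_finite_image (f := Subtype.val) ?_ Subtype.val_injective.injOn
  refine (Set.finite_of_encard_le_coe (K.regular y.1 y.2.1)).subset ?_
  rintro _ ⟨z, hz, rfl⟩
  obtain ⟨v, hv, h⟩ := incidence_ne_zero hz
  refine ⟨z.2.1, ?_, ?_⟩
  · rw [← h]; exact Finset.erase_subset v _
  · rw [← h]; exact (Finset.card_erase_add_one hv).symm

variable (K)

/-- The boundary operator `∂ x = ∑ y, ε(x, y) y`, `y` running over the `(n-1)`-simplices. -/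
def boundary (n : ℤ) : Chain K n →+ Chain K (n - 1) :=
  Finsupp.liftAddHom fun x => (zmultiplesHom (Chain K (n - 1)))
    (Finsupp.ofSupportFinite (fun y => incidence K x.1 y.1) (finite_faces x.1))

/-- The coboundary operator `x ↦ ∑ z, ε(z, x) z`, `z` running over the `(n+1)`-simplices. -/
def coboundary (n : ℤ) : Chain K n →+ Chain K (n + 1) :=
  Finsupp.liftAddHom fun x => (zmultiplesHom (Chain K (n + 1)))
    (Finsupp.ofSupportFinite (fun z => incidence K z.1 x.1) (finite_cofaces x))

/-- Index of the components `C_n → G_j`, `j = n - p`, of a map of degree `p`. -/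
structure DegIdx (p : ℤ) where
  n : ℤ
  j : ℤ
  deg : n - j = p

variable (𝔾 : ChainComplex AddCommGrpCat.{w} ℤ)

/-- `Hom(C,G)^p`: families of homomorphisms `t_n : C_n → G_{n-p}`. -/
abbrev PMap (p : ℤ) : Type (max u w) := ∀ i : DegIdx p, Chain K i.n →+ 𝔾.X i.j

/-- `Hom(C,G)_p`: families of homomorphisms `γ_n` from `C_n` to the character group
of `G_{n-p}`, written additively. -/
abbrev DualPMap (p : ℤ) : Type (max u w) :=
  ∀ i : DegIdx p, Chain K i.n →+ AddChar (𝔾.X i.j) Circle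

/-- The adjoint `α ↦ α ∘ ∂` of the boundary map `∂ : G_j → G_i`. -/
def dualBoundary (i j : ℤ) : AddChar (𝔾.X i) Circle →+ AddChar (𝔾.X j) Circle where
  toFun α := α.compAddMonoidHom (𝔾.d j i).hom
  map_zero' := rfl
  map_add' _ _ := rfl

variable {K 𝔾}

/-- `(δ^p t)_n = t_{n-1} ∘ ∂_n - (-1)^p ∂_{n-p} ∘ t_n`, with `q = p + 1`. -/
def delta (p q : ℤ) (hpq : p + 1 = q) (t : PMap K 𝔾 p) : PMap K 𝔾 q := fun i =>
  (t ⟨i.n - 1, i.j, by have := i.deg; omega⟩).comp (boundary K i.n) -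
    (p.negOnePow : ℤ) •
      (𝔾.d (i.j + 1) i.j).hom.comp (t ⟨i.n, i.j + 1, by have := i.deg; omega⟩)

/-- `(δ_p γ)_n = γ_{n+1} ∘ ∂̂_{n+1} - (-1)^(p-1) ∂̂_{n+1-p} ∘ γ_n`, with `q = p - 1`. The sign is the
one that makes `δ_p` adjoint to `δ^(p-1)`, i.e. `γ(δ^(p-1) t) = (δ_p γ)(t)`. -/
def deltaDual (p q : ℤ) (hpq : q + 1 = p) (γ : DualPMap K 𝔾 p) : DualPMap K 𝔾 q := fun i =>
  (γ ⟨i.n + 1, i.j, by have := i.deg; omega⟩).comp (coboundary K i.n) -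
    (q.negOnePow : ℤ) •
      (dualBoundary 𝔾 (i.j - 1) i.j).comp (γ ⟨i.n, i.j - 1, by have := i.deg; omega⟩)

/-- The simplices at which `f` does not vanish. -/
def suppHom {A : Type*} [AddCommGroup A] {n : ℤ} (f : Chain K n →+ A) : Set (Simplex K n) :=
  {x | f (Finsupp.single x 1) ≠ 0}

theorem zsmul_hom_apply {C A : Type*} [AddCommGroup C] [AddCommGroup A] (n : ℤ) (f : C →+ A)
    (c : C) : (n • f) c = n • f c := rfl

theorem sub_zsmul_apply_eq_zero {C A : Type*} [AddCommGroup C] [AddCommGroup A] (n : ℤ)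
    (f : C →+ A) {A' : Type*} [AddCommGroup A'] (g : C →+ A') (e : A' →+ A) {c : C}
    (hf : f c = 0) (hg : g c = 0) : (f - n • e.comp g) c = 0 := by
  rw [AddMonoidHom.sub_apply, zsmul_hom_apply, AddMonoidHom.comp_apply, hf, hg, map_zero,
    smul_zero, sub_zero]

theorem suppHom_zero {A : Type*} [AddCommGroup A] {n : ℤ} :
    suppHom (0 : Chain K n →+ A) = ∅ := by
  simp [suppHom]

theorem suppHom_add {A : Type*} [AddCommGroup A] {n : ℤ} (f g : Chain K n →+ A) :
    suppHom (f + g) ⊆ suppHom f ∪ suppHom g := by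
  intro x hx
  by_contra H
  simp only [suppHom, Set.mem_union, Set.mem_ofPred_eq, not_or, not_not] at H hx
  exact hx (by rw [AddMonoidHom.add_apply, H.1, H.2, add_zero])

theorem suppHom_neg {A : Type*} [AddCommGroup A] {n : ℤ} (f : Chain K n →+ A) :
    suppHom (-f) = suppHom f := by
  ext x
  simp [suppHom]

variable (K 𝔾)

/-- `Hom₀(C,G)^p`: the compactly supported elements of `Hom(C,G)^p`. -/
def PMap₀ (p : ℤ) : AddSubgroup (PMap K 𝔾 p) where
  carrier := {t | ∀ i, (suppHom (t i)).Finite}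
  zero_mem' i := by simp [suppHom_zero]
  add_mem' hs ht i := ((hs i).union (ht i)).subset (suppHom_add _ _)
  neg_mem' ht i := by rw [Pi.neg_apply, suppHom_neg]; exact ht i

/-- `Hom₀(C,G)_p`: the compactly supported elements of `Hom(C,G)_p`. -/
def DualPMap₀ (p : ℤ) : AddSubgroup (DualPMap K 𝔾 p) where
  carrier := {γ | ∀ i, (suppHom (γ i)).Finite}
  zero_mem' i := by simp [suppHom_zero]
  add_mem' hs ht i := ((hs i).union (ht i)).subset (suppHom_add _ _)
  neg_mem' ht i := by rw [Pi.neg_apply, suppHom_neg]; exact ht i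

variable {K 𝔾}

theorem exists_of_apply_ne_zero {A : Type*} [AddCommGroup A] {n : ℤ} (f : Chain K n →+ A)
    {c : Chain K n} (h : f c ≠ 0) : ∃ y ∈ suppHom f, c y ≠ 0 := by
  by_contra! H
  refine h ?_
  rw [← Finsupp.sum_single c, Finsupp.sum, map_sum]
  refine Finset.sum_eq_zero fun y hy => ?_
  have h1 : f (Finsupp.single y 1) = 0 := by
    by_contra h2
    exact Finsupp.mem_support_iff.mp hy (H y h2)
  rw [← smul_eq_mul_one_single c y, map_zsmul, h1, smul_zero]
where
  smul_eq_mul_one_single {n : ℤ} (c : Chain K n) (y : Simplex K n) :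
      c y • (Finsupp.single y 1 : Chain K n) = Finsupp.single y (c y) := by simp

theorem boundary_single (n : ℤ) (x : Simplex K n) (y : Simplex K (n - 1)) :
    boundary K n (Finsupp.single x 1) y = incidence K x.1 y.1 := by
  rw [boundary, Finsupp.liftAddHom_apply_single, zmultiplesHom_apply, one_zsmul]
  rfl

theorem coboundary_single (n : ℤ) (x : Simplex K n) (z : Simplex K (n + 1)) :
    coboundary K n (Finsupp.single x 1) z = incidence K z.1 x.1 := by
  rw [coboundary, Finsupp.liftAddHom_apply_single, zmultiplesHom_apply, one_zsmul]
  rfl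

theorem delta_mem (p q : ℤ) (hpq : p + 1 = q) {t : PMap K 𝔾 p} (ht : t ∈ PMap₀ K 𝔾 p) :
    delta p q hpq t ∈ PMap₀ K 𝔾 q := by
  intro i
  refine (((ht ⟨i.n - 1, i.j, by have := i.deg; omega⟩).biUnion
    fun y _ => finite_cofaces (m := i.n) y).union
      (ht ⟨i.n, i.j + 1, by have := i.deg; omega⟩)).subset ?_
  intro x hx
  by_contra H
  simp only [Set.mem_union, not_or] at H
  refine hx ?_
  have h1 : t ⟨i.n - 1, i.j, by have := i.deg; omega⟩
      (boundary K i.n (Finsupp.single x 1)) = 0 := by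
    by_contra h
    obtain ⟨y, hy, hy'⟩ := exists_of_apply_ne_zero _ h
    rw [boundary_single] at hy'
    exact H.1 (Set.mem_biUnion hy hy')
  have h2 : t ⟨i.n, i.j + 1, by have := i.deg; omega⟩ (Finsupp.single x 1) = 0 := by
    by_contra h
    exact H.2 h
  exact sub_zsmul_apply_eq_zero _ _ _ _ h1 h2

theorem deltaDual_mem (p q : ℤ) (hpq : q + 1 = p) {γ : DualPMap K 𝔾 p}
    (hγ : γ ∈ DualPMap₀ K 𝔾 p) : deltaDual p q hpq γ ∈ DualPMap₀ K 𝔾 q := by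
  intro i
  refine (((hγ ⟨i.n + 1, i.j, by have := i.deg; omega⟩).biUnion
    fun z _ => finite_faces (m := i.n) z.1).union
      (hγ ⟨i.n, i.j - 1, by have := i.deg; omega⟩)).subset ?_
  intro x hx
  by_contra H
  simp only [Set.mem_union, not_or] at H
  refine hx ?_
  have h1 : γ ⟨i.n + 1, i.j, by have := i.deg; omega⟩
      (coboundary K i.n (Finsupp.single x 1)) = 0 := by
    by_contra h
    obtain ⟨z, hz, hz'⟩ := exists_of_apply_ne_zero _ h
    rw [coboundary_single] at hz'
    exact H.1 (Set.mem_biUnion hz hz')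
  have h2 : γ ⟨i.n, i.j - 1, by have := i.deg; omega⟩ (Finsupp.single x 1) = 0 := by
    by_contra h
    exact H.2 h
  exact sub_zsmul_apply_eq_zero _ _ _ _ h1 h2

/-- `δ^p` on compactly supported maps. -/
def delta₀ (p q : ℤ) (hpq : p + 1 = q) (t : PMap₀ K 𝔾 p) : PMap₀ K 𝔾 q :=
  ⟨delta p q hpq t.1, delta_mem p q hpq t.2⟩

/-- `δ_p` on compactly supported dual maps. -/
def deltaDual₀ (p q : ℤ) (hpq : q + 1 = p) (γ : DualPMap₀ K 𝔾 p) : DualPMap₀ K 𝔾 q :=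
  ⟨deltaDual p q hpq γ.1, deltaDual_mem p q hpq γ.2⟩

/-- A family of homomorphisms in degree `0` with finite supports vanishes at all but finitely many
simplices, because the dimension is finite. -/
theorem finite_support_zero {A : ℤ → Type*} [∀ n, AddCommGroup (A n)]
    (f : ∀ n, Chain K n →+ A n) (hf : ∀ n, (suppHom (f n)).Finite) :
    {x : Site K | f x.1 (Finsupp.single x.2 1) ≠ 0}.Finite := by
  refine ((Set.finite_Icc (-1 : ℤ) K.dim).biUnion
    fun n _ => (hf n).image (Sigma.mk n)).subset ?_
  rintro ⟨n, x⟩ hx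
  have h1 := K.card_le x.1 x.2.1
  have h2 := x.2.2
  refine Set.mem_biUnion (x := n) ⟨by omega, by omega⟩ ⟨x, hx, rfl⟩

/-- The group at a simplex `x` of dimension `n` is `G_n`. -/
abbrev SiteGroup (K : GeometricData V) (𝔾 : ChainComplex AddCommGrpCat.{w} ℤ) (x : Site K) :
    Type w := 𝔾.X x.1

open scoped Classical in
/-- A compactly supported `0`-map as a configuration `x ↦ t_n(x)`. -/
def toConf (t : PMap₀ K 𝔾 0) : Conf (SiteGroup K 𝔾) :=
  DFinsupp.mk
    (finite_support_zero (fun n => t.1 ⟨n, n, sub_self n⟩) (fun n => t.2 ⟨n, n, sub_self n⟩)).toFinset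
    (fun x => t.1 ⟨x.1.1, x.1.1, sub_self x.1.1⟩ (Finsupp.single x.1.2 1))

theorem toConf_apply (t : PMap₀ K 𝔾 0) (x : Site K) :
    toConf t x = t.1 ⟨x.1, x.1, sub_self x.1⟩ (Finsupp.single x.2 1) := by
  classical
  rw [toConf, DFinsupp.mk_apply]
  split_ifs with h
  · rfl
  · simp only [Set.Finite.mem_toFinset, Set.mem_ofPred_eq, not_not] at h
    exact h.symm

open scoped Classical in
/-- A compactly supported dual `0`-map as a family of characters `x ↦ γ_n(x)`. -/
def toDualConf (γ : DualPMap₀ K 𝔾 0) : Π₀ x : Site K, AddChar (SiteGroup K 𝔾 x) Circle :=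
  DFinsupp.mk
    (finite_support_zero (fun n => γ.1 ⟨n, n, sub_self n⟩) (fun n => γ.2 ⟨n, n, sub_self n⟩)).toFinset
    (fun x => γ.1 ⟨x.1.1, x.1.1, sub_self x.1.1⟩ (Finsupp.single x.1.2 1))

theorem toDualConf_apply (γ : DualPMap₀ K 𝔾 0) (x : Site K) :
    toDualConf γ x = γ.1 ⟨x.1, x.1, sub_self x.1⟩ (Finsupp.single x.2 1) := by
  classical
  rw [toDualConf, DFinsupp.mk_apply]
  split_ifs with h
  · rfl
  · simp only [Set.Finite.mem_toFinset, Set.mem_ofPred_eq, not_not] at h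
    exact h.symm

variable [∀ j, Finite (𝔾.X j)]

instance (x : Site K) : Finite (SiteGroup K 𝔾 x) := inferInstanceAs (Finite (𝔾.X x.1))

/-- The shift operator `P_t : |h⟩ ↦ |t + h⟩`. -/
def P (t : PMap₀ K 𝔾 0) : quasiLocal (SiteGroup K 𝔾) := ⟨shiftOp (toConf t), shiftOp_mem _⟩

/-- The clock operator `Q_γ : |h⟩ ↦ γ(h) |h⟩`. -/
def Q (γ : DualPMap₀ K 𝔾 0) : quasiLocal (SiteGroup K 𝔾) :=
  ⟨clockOp (toDualConf γ), clockOp_mem _⟩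

/-- `A_t = P_{δ^{-1} t}`. -/
def A (t : PMap₀ K 𝔾 (-1)) : quasiLocal (SiteGroup K 𝔾) := P (delta₀ (-1) 0 (by norm_num) t)

/-- `B_γ = Q_{δ_1 γ}`. -/
def B (γ : DualPMap₀ K 𝔾 1) : quasiLocal (SiteGroup K 𝔾) := Q (deltaDual₀ 1 0 (by norm_num) γ)

variable (K 𝔾)

/-- The core algebra: the C⋆-subalgebra of the quasi-local algebra generated by the operators `A_t`
and `B_γ`. -/
def core : StarSubalgebra ℂ (quasiLocal (SiteGroup K 𝔾)) :=
  (StarAlgebra.adjoin ℂ (Set.range (A (K := K) (𝔾 := 𝔾)) ∪ Set.range B)).topologicalClosure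

variable {K 𝔾}

theorem A_mem_core (t : PMap₀ K 𝔾 (-1)) : A t ∈ core K 𝔾 :=
  StarSubalgebra.le_topologicalClosure _ (StarAlgebra.subset_adjoin ℂ _ (Or.inl ⟨t, rfl⟩))

theorem B_mem_core (γ : DualPMap₀ K 𝔾 1) : B γ ∈ core K 𝔾 :=
  StarSubalgebra.le_topologicalClosure _ (StarAlgebra.subset_adjoin ℂ _ (Or.inr ⟨γ, rfl⟩))

/-- `A_t` as an element of the core algebra. -/
def coreA (t : PMap₀ K 𝔾 (-1)) : core K 𝔾 := ⟨A t, A_mem_core t⟩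

/-- `B_γ` as an element of the core algebra. -/
def coreB (γ : DualPMap₀ K 𝔾 1) : core K 𝔾 := ⟨B γ, B_mem_core γ⟩

end Complex

/-! ## States -/

section States

variable (𝔅 : Type*) [Ring 𝔅] [StarRing 𝔅] [Algebra ℂ 𝔅]

/-- The state space: positive linear functionals `ω` with `ω(1) = 1`. -/
def stateSpace : Set (𝔅 →ₗ[ℂ] ℂ) := {ω | (∀ a, 0 ≤ ω (star a * a)) ∧ ω 1 = 1}

/-- The pure states: the extreme points of the state space. -/
def pureStates : Set (𝔅 →ₗ[ℂ] ℂ) := (stateSpace 𝔅).extremePoints ℝ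

end States

end HigherQDM

end

noncomputable section

/-! Everything rests on one duality: `δ_1 γ` annihilates `δ^{-1} t` for all `t`, `γ`
(`charValue_deltaDual_delta`). In dimension `n` the pairing of the two expands into four terms. Two
vanish because the simplicial boundary and the boundary of `𝔾` square to zero. The other two are
consecutive members of one sequence of mixed pairings, so the sum over `n` telescopes, and both ends
are zero because there are no simplices of negative dimension or of dimension above `K.dim`.

The phase in the commutation relation of a shift with a clock is exactly this pairing, so the `A_t`
and `B_γ` commute and the core is abelian (`core_mul_comm`). The products `A_t B_γ` then form a
group of unitaries, and their linear span is dense in the core (`dense_span_stabilizers`).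

Existence: given finitely many such products, let `D` be the group of all configurations `δ^{-1} t`
and add up the basis vectors `|h⟩` over the `h` in `D` supported in a large finite region. The
shifts permute these vectors and the clocks are trivial on them, so the sum is a nonzero common
fixed vector (`exists_common_fixed_vector`). Hence the elements `u - 1`, `u` a product `A_t B_γ`,
generate a proper ideal. A maximal ideal above it is the kernel of a character, which is the state
sought (`exists_multiplicative_state`).

Uniqueness: states are continuous and are prescribed here on a set with dense span. Purity: states
map unitaries into the closed unit disc, of which `1` is an extreme point, so the endpoints of a
segment through the seed state take the value `1` on the same unitaries and coincide with it by
uniqueness. -/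

namespace HigherQDM

/-! ### Incidence numbers and the vanishing of the squared boundary. -/

section Incidence

variable {V : Type u} [LinearOrder V] {K : GeometricData V}

/-- The sign with which the face of `x` opposite to `v` occurs in the boundary of `x`. -/
def faceSign (K : GeometricData V) (x : Finset V) (v : V) : ℤ :=
  ((K.orient x * K.orient (x.erase v) : ℤˣ) : ℤ) * (-1) ^ (x.filter (· < v)).card

theorem incidence_eq_sum (x y : Finset V) :
    incidence K x y = ∑ v ∈ x, if x.erase v = y then faceSign K x v else 0 := by
  refine Finset.sum_congr rfl fun v _ => ?_
  split_ifs with h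
  · rw [faceSign, h]
  · rfl

/-- Deleting a smaller vertex moves `w` one position down, while deleting `w` leaves the position of
a smaller vertex unchanged. This asymmetry is the only source of the sign in `faceSign_swap`. -/
theorem card_filter_lt_erase {x : Finset V} {v w : V} (hv : v ∈ x) (hvw : v < w) :
    (x.filter (· < w)).card = ((x.erase v).filter (· < w)).card + 1 := by
  rw [Finset.filter_erase, Finset.card_erase_add_one (Finset.mem_filter.mpr ⟨hv, hvw⟩)]

theorem card_filter_lt_erase_of_le {x : Finset V} {v w : V} (hwv : w ≤ v) :
    ((x.erase v).filter (· < w)).card = (x.filter (· < w)).card := by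
  rw [Finset.filter_erase, Finset.erase_eq_of_notMem]
  simp [hwv]

/-- The orientation of the intermediate face enters twice and squares to `1`, so the chosen
orientations contribute the same factor for either order of deletion. -/
theorem faceSign_mul_faceSign (x : Finset V) (v w : V) :
    faceSign K x v * faceSign K (x.erase v) w =
      ((K.orient x * K.orient ((x.erase v).erase w) : ℤˣ) : ℤ) *
        (-1) ^ ((x.filter (· < v)).card + ((x.erase v).filter (· < w)).card) := by
  have h : ((K.orient (x.erase v) : ℤˣ) : ℤ) * (K.orient (x.erase v) : ℤˣ) = 1 := by
    rw [← Units.val_mul, Int.units_mul_self, Units.val_one]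
  rw [faceSign, faceSign, pow_add, Units.val_mul, Units.val_mul, Units.val_mul]
  linear_combination ((K.orient x : ℤˣ) : ℤ) * (K.orient ((x.erase v).erase w) : ℤˣ) *
    (-1) ^ (x.filter (· < v)).card * (-1) ^ ((x.erase v).filter (· < w)).card * h

/-- Removing two vertices in the two possible orders gives opposite signs. -/
theorem faceSign_swap {x : Finset V} {v w : V} (hv : v ∈ x) (hw : w ∈ x) (hvw : v ≠ w) :
    faceSign K x v * faceSign K (x.erase v) w +
      faceSign K x w * faceSign K (x.erase w) v = 0 := by
  wlog h : v < w generalizing v w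
  · rw [add_comm]
    exact this hw hv hvw.symm (lt_of_le_of_ne (not_lt.mp h) hvw.symm)
  rw [faceSign_mul_faceSign, faceSign_mul_faceSign, Finset.erase_right_comm (a := w),
    card_filter_lt_erase_of_le h.le, card_filter_lt_erase hv h]
  ring

/-- The terms are indexed by ordered pairs of distinct vertices of `x`; exchanging the two is a
fixed-point-free involution that reverses the sign. -/
theorem sum_faceSign_mul_incidence (x z : Finset V) :
    ∑ v ∈ x, faceSign K x v * incidence K (x.erase v) z = 0 := by
  simp only [incidence_eq_sum, Finset.mul_sum, mul_ite, mul_zero]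
  rw [Finset.sum_sigma']
  refine Finset.sum_involution (fun p _ => ⟨p.2, p.1⟩) ?_ ?_ ?_ ?_
  · rintro ⟨v, w⟩ h
    simp only [Finset.mem_sigma, Finset.mem_erase] at h
    simp only [Finset.erase_right_comm (a := w)]
    split_ifs
    · exact faceSign_swap h.1 h.2.2 h.2.1.symm
    · exact add_zero 0
  · rintro ⟨v, w⟩ h _ h'
    simp only [Finset.mem_sigma, Finset.mem_erase] at h
    exact h.2.1 (congrArg Sigma.fst h')
  · rintro ⟨v, w⟩ h
    simp only [Finset.mem_sigma, Finset.mem_erase] at h ⊢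
    exact ⟨h.2.2, h.2.1.symm, h.1⟩
  · rintro ⟨v, w⟩ _
    rfl

theorem incidence_mul_incidence {n m k : ℤ} (hnm : n = m + 1) (x : Simplex K n) (z : Simplex K k)
    (T : Finset (Simplex K m)) (hT : ∀ y : Simplex K m, y.1 ⊆ x.1 → y ∈ T) :
    ∑ y ∈ T, incidence K x.1 y.1 * incidence K y.1 z.1 = 0 := by
  rw [← sum_faceSign_mul_incidence x.1 z.1]
  simp only [incidence_eq_sum x.1, Finset.sum_mul, ite_mul, zero_mul]
  rw [Finset.sum_comm]
  refine Finset.sum_congr rfl fun v hv => ?_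
  by_cases h0 : incidence K (x.1.erase v) z.1 = 0
  · rw [h0, mul_zero]
    refine Finset.sum_eq_zero fun y _ => ?_
    split_ifs with h
    · rw [← h, h0, mul_zero]
    · rfl
  -- A nonzero incidence number provides a vertex of the face, which is therefore nonempty and
  -- really is a simplex of the complex.
  · obtain ⟨w, hw, -⟩ := incidence_ne_zero h0
    have hc := Finset.card_erase_add_one hv
    have hx := x.2.2
    have hmem : x.1.erase v ∈ K.complex :=
      (K.complex.isRelLowerSet_faces x.2.1).2 (Finset.erase_subset v _) ⟨w, hw⟩
    have hcard : ((x.1.erase v).card : ℤ) = m + 1 := by omega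
    let y₀ : Simplex K m := ⟨x.1.erase v, hmem, hcard⟩
    refine (Finset.sum_eq_single y₀ ?_ ?_).trans (if_pos rfl)
    · intro y _ hy
      exact if_neg fun h => hy (Subtype.ext h.symm)
    · intro h
      exact (h (hT _ (Finset.erase_subset v _))).elim

variable (K)

/-- The map `x ↦ ∑ y, ε(x, y) y` from `n`-chains to `m`-chains; the boundary if `m = n - 1`. -/
def chainBoundary (n m : ℤ) : Chain K n →+ Chain K m :=
  Finsupp.liftAddHom fun x => (zmultiplesHom (Chain K m))
    (Finsupp.ofSupportFinite (fun y => incidence K x.1 y.1) (finite_faces x.1))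

/-- The map `y ↦ ∑ x, ε(x, y) x` from `m`-chains to `n`-chains; the coboundary if `n = m + 1`. -/
def chainCoboundary (m n : ℤ) : Chain K m →+ Chain K n :=
  Finsupp.liftAddHom fun y => (zmultiplesHom (Chain K n))
    (Finsupp.ofSupportFinite (fun x => incidence K x.1 y.1) (finite_cofaces y))

variable {K}

theorem chainBoundary_single (n m : ℤ) (x : Simplex K n) (y : Simplex K m) :
    chainBoundary K n m (Finsupp.single x 1) y = incidence K x.1 y.1 := by
  rw [chainBoundary, Finsupp.liftAddHom_apply_single, zmultiplesHom_apply, one_zsmul]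
  rfl

theorem chainCoboundary_single (m n : ℤ) (y : Simplex K m) (x : Simplex K n) :
    chainCoboundary K m n (Finsupp.single y 1) x = incidence K x.1 y.1 := by
  rw [chainCoboundary, Finsupp.liftAddHom_apply_single, zmultiplesHom_apply, one_zsmul]
  rfl

/-- A homomorphism on chains as a sum over a finite set of simplices that carries all the non-zero
terms. -/
theorem map_chain_eq_sum {A : Type*} [AddCommGroup A] {n : ℤ} (f : Chain K n →+ A)
    (c : Chain K n) (T : Finset (Simplex K n))
    (hT : ∀ y, c y ≠ 0 → f (Finsupp.single y 1) ≠ 0 → y ∈ T) :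
    f c = ∑ y ∈ T, c y • f (Finsupp.single y 1) := by
  classical
  have h1 : f c = ∑ y ∈ c.support, c y • f (Finsupp.single y 1) := by
    conv_lhs => rw [← Finsupp.sum_single c, Finsupp.sum, map_sum]
    refine Finset.sum_congr rfl fun y _ => ?_
    rw [← map_zsmul, Finsupp.smul_single, smul_eq_mul, mul_one]
  rw [h1]
  have h2 : ∀ y, c y • f (Finsupp.single y 1) ≠ 0 → c y ≠ 0 ∧ f (Finsupp.single y 1) ≠ 0 :=
    fun y hy => ⟨fun h => hy (by rw [h, zero_smul]), fun h => hy (by rw [h, smul_zero])⟩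
  rw [← Finset.sum_filter_ne_zero, ← Finset.sum_filter_ne_zero (s := T)]
  refine Finset.sum_congr ?_ fun _ _ => rfl
  ext y
  simp only [Finset.mem_filter, Finsupp.mem_support_iff]
  exact ⟨fun h => ⟨hT y (h2 y h.2).1 (h2 y h.2).2, h.2⟩, fun h => ⟨(h2 y h.2).1, h.2⟩⟩

/-- Keeping the degrees as free variables tied by an equation avoids transport between types such as
`Chain K (n + 1 - 1)` and `Chain K n`. -/
theorem chainBoundary_chainBoundary {n m k : ℤ} (hnm : n = m + 1) :
    (chainBoundary K m k).comp (chainBoundary K n m) = 0 := by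
  refine Finsupp.addHom_ext' fun x => AddMonoidHom.ext_int ?_
  ext z
  have hfin : {y : Simplex K m | y.1 ⊆ x.1}.Finite := by
    refine Set.Finite.of_finite_image (f := Subtype.val) ?_ Subtype.val_injective.injOn
    refine (x.1.powerset.finite_toSet).subset ?_
    rintro _ ⟨y, hy, rfl⟩
    simpa using hy
  have key := map_chain_eq_sum ((Finsupp.applyAddHom z).comp (chainBoundary K m k))
    (chainBoundary K n m (Finsupp.single x 1)) hfin.toFinset (by
      intro y hy _
      rw [chainBoundary_single] at hy
      obtain ⟨v, _, h⟩ := incidence_ne_zero hy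
      simp [← h, Finset.erase_subset])
  simp only [AddMonoidHom.comp_apply, Finsupp.applyAddHom_apply, chainBoundary_single,
    smul_eq_mul] at key
  simp only [AddMonoidHom.comp_apply, Finsupp.singleAddHom_apply, AddMonoidHom.zero_apply,
    Finsupp.zero_apply]
  rw [key]
  exact incidence_mul_incidence hnm x z _ fun y hy => by simpa using hy

end Incidence

/-! ### The pairing of character-valued with group-valued homomorphisms. -/

section Pairing

variable {V : Type u} [LinearOrder V] {K : GeometricData V}
variable {G : Type w} [AddCommGroup G] {n m : ℤ}

/-- The pairing `∏ x, f(x)(t(x))`, over the `n`-simplices `x`, written additively. -/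
def pairing (f : Chain K n →+ AddChar G Circle) (t : Chain K n →+ G) : Additive Circle :=
  ∑ᶠ x : Simplex K n,
    Additive.ofMul (f (Finsupp.single x 1) (t (Finsupp.single x 1)))

/-- Characters send `0` to `1`, so only the support of `t` matters and no finiteness is asked of
`f`. -/
theorem pairing_eq_sum (f : Chain K n →+ AddChar G Circle) (t : Chain K n →+ G)
    (T : Finset (Simplex K n)) (hT : suppHom t ⊆ T) :
    pairing f t = ∑ x ∈ T, Additive.ofMul (f (Finsupp.single x 1) (t (Finsupp.single x 1))) := by
  refine finsum_eq_sum_of_support_subset _ fun x hx => hT fun h => hx ?_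
  beta_reduce
  rw [h, AddChar.map_zero_eq_one, ofMul_one]

theorem pairing_zero_right (f : Chain K n →+ AddChar G Circle) : pairing f 0 = 0 := by
  rw [pairing_eq_sum f 0 ∅ (by rw [suppHom_zero]; exact Set.empty_subset _), Finset.sum_empty]

theorem pairing_add_right (f : Chain K n →+ AddChar G Circle) {s t : Chain K n →+ G}
    (hs : (suppHom s).Finite) (ht : (suppHom t).Finite) :
    pairing f (s + t) = pairing f s + pairing f t := by
  classical
  rw [pairing_eq_sum f s (hs.toFinset ∪ ht.toFinset) (by simp),
    pairing_eq_sum f t (hs.toFinset ∪ ht.toFinset) (by simp),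
    pairing_eq_sum f (s + t) (hs.toFinset ∪ ht.toFinset) (by simpa using suppHom_add s t),
    ← Finset.sum_add_distrib]
  refine Finset.sum_congr rfl fun x _ => ?_
  rw [AddMonoidHom.add_apply, AddChar.map_add_eq_mul, ofMul_mul]

theorem pairing_sub_left (f g : Chain K n →+ AddChar G Circle) {t : Chain K n →+ G}
    (ht : (suppHom t).Finite) : pairing (f - g) t = pairing f t - pairing g t := by
  rw [pairing_eq_sum f t ht.toFinset (by simp), pairing_eq_sum g t ht.toFinset (by simp),
    pairing_eq_sum (f - g) t ht.toFinset (by simp), ← Finset.sum_sub_distrib]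
  refine Finset.sum_congr rfl fun x _ => ?_
  rw [AddMonoidHom.sub_apply, AddChar.sub_apply', ofMul_div]

/-- A character applied to an integer combination, written additively. -/
theorem ofMul_addChar_sum {κ : Type*} (α : AddChar G Circle) (s : Finset κ) (c : κ → ℤ)
    (g : κ → G) :
    Additive.ofMul (α (∑ k ∈ s, c k • g k)) = ∑ k ∈ s, c k • Additive.ofMul (α (g k)) := by
  change α.toAddMonoidHom _ = ∑ k ∈ s, c k • α.toAddMonoidHom (g k)
  rw [map_sum]
  simp only [map_zsmul]

theorem ofMul_sum_addChar {κ : Type*} (g : G) (s : Finset κ) (c : κ → ℤ)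
    (α : κ → AddChar G Circle) :
    Additive.ofMul ((∑ k ∈ s, c k • α k) g) = ∑ k ∈ s, c k • Additive.ofMul (α k g) := by
  let e : AddChar G Circle →+ Additive Circle :=
    { toFun := fun α => Additive.ofMul (α g)
      map_zero' := rfl
      map_add' := fun _ _ => rfl }
  change e _ = ∑ k ∈ s, c k • e (α k)
  rw [map_sum]
  simp only [map_zsmul]

/-- A simplex in the new support has a face in the old one; regularity of the complex leaves
finitely many such simplices. -/
theorem suppHom_comp_chainBoundary {t : Chain K m →+ G} (ht : (suppHom t).Finite) :
    (suppHom (t.comp (chainBoundary K n m))).Finite := by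
  refine (ht.biUnion fun y _ => finite_cofaces (m := n) y).subset fun x hx => ?_
  obtain ⟨y, hy, hy'⟩ := exists_of_apply_ne_zero t hx
  rw [chainBoundary_single] at hy'
  exact Set.mem_biUnion hy hy'

/-- The coboundary is adjoint to the boundary. -/
theorem pairing_comp_chainCoboundary (f : Chain K n →+ AddChar G Circle) {t : Chain K m →+ G}
    (ht : (suppHom t).Finite) :
    pairing (f.comp (chainCoboundary K m n)) t = pairing f (t.comp (chainBoundary K n m)) := by
  have hX := ht.biUnion fun y _ => finite_cofaces (m := n) y
  rw [pairing_eq_sum _ t ht.toFinset (by simp),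
    pairing_eq_sum f _ hX.toFinset (by
      intro x hx
      obtain ⟨y, hy, hy'⟩ := exists_of_apply_ne_zero t hx
      rw [chainBoundary_single] at hy'
      rw [Set.Finite.coe_toFinset]
      exact Set.mem_biUnion hy hy')]
  have h1 : ∀ y ∈ ht.toFinset, f.comp (chainCoboundary K m n) (Finsupp.single y 1) =
      ∑ x ∈ hX.toFinset, incidence K x.1 y.1 • f (Finsupp.single x 1) := by
    intro y hy
    rw [AddMonoidHom.comp_apply, map_chain_eq_sum f _ hX.toFinset]
    · simp only [chainCoboundary_single]
    · intro x hx _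
      rw [chainCoboundary_single] at hx
      rw [Set.Finite.mem_toFinset] at hy ⊢
      exact Set.mem_biUnion hy hx
  have h2 : ∀ x, t.comp (chainBoundary K n m) (Finsupp.single x 1) =
      ∑ y ∈ ht.toFinset, incidence K x.1 y.1 • t (Finsupp.single y 1) := by
    intro x
    rw [AddMonoidHom.comp_apply, map_chain_eq_sum t _ ht.toFinset]
    · simp only [chainBoundary_single]
    · intro y _ hy
      rw [Set.Finite.mem_toFinset]
      exact hy
  -- Both sides are double sums of `g`, one for each order of summation.
  let g (y : Simplex K m) (x : Simplex K n) : Additive Circle :=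
    incidence K x.1 y.1 • Additive.ofMul (f (Finsupp.single x 1) (t (Finsupp.single y 1)))
  calc
    _ = ∑ y ∈ ht.toFinset, ∑ x ∈ hX.toFinset, g y x :=
      Finset.sum_congr rfl fun y hy => by rw [h1 y hy, ofMul_sum_addChar]
    _ = ∑ x ∈ hX.toFinset, ∑ y ∈ ht.toFinset, g y x := Finset.sum_comm
    _ = _ := Finset.sum_congr rfl fun x _ => by rw [h2 x, ofMul_addChar_sum]

end Pairing
-- States on C⋆-algebras: continuity, uniqueness, purity, existence of characters.
section AbstractStates

variable {𝔅 : Type*} [CStarAlgebra 𝔅]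

/-- Nonnegative elements for the spectral order are exactly the `star b * b`. The passage to a
bundled positive map yields automatic continuity and compatibility with `star`. -/
theorem exists_positiveLinearMap_of_mem_stateSpace {ω : 𝔅 →ₗ[ℂ] ℂ} (hω : ω ∈ stateSpace 𝔅) :
    letI := CStarAlgebra.spectralOrder 𝔅
    ∃ f : 𝔅 →ₚ[ℂ] ℂ, f.toLinearMap = ω := by
  let _ := CStarAlgebra.spectralOrder 𝔅
  have := CStarAlgebra.spectralOrderedRing 𝔅
  refine ⟨PositiveLinearMap.mk₀ ω fun a ha => ?_, rfl⟩
  obtain ⟨b, rfl⟩ := CStarAlgebra.nonneg_iff_eq_star_mul_self.mp ha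
  exact hω.1 b

theorem continuous_of_mem_stateSpace {ω : 𝔅 →ₗ[ℂ] ℂ} (hω : ω ∈ stateSpace 𝔅) :
    Continuous ω := by
  let _ := CStarAlgebra.spectralOrder 𝔅
  have := CStarAlgebra.spectralOrderedRing 𝔅
  obtain ⟨f, rfl⟩ := exists_positiveLinearMap_of_mem_stateSpace hω
  exact map_continuous f

theorem map_star_of_mem_stateSpace {ω : 𝔅 →ₗ[ℂ] ℂ} (hω : ω ∈ stateSpace 𝔅) (a : 𝔅) :
    ω (star a) = star (ω a) := by
  let _ := CStarAlgebra.spectralOrder 𝔅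
  have := CStarAlgebra.spectralOrderedRing 𝔅
  obtain ⟨f, rfl⟩ := exists_positiveLinearMap_of_mem_stateSpace hω
  exact map_star f a

/-- States are bounded by `1` on unitaries. -/
theorem normSq_apply_le_one {ω : 𝔅 →ₗ[ℂ] ℂ} (hω : ω ∈ stateSpace 𝔅) {u : 𝔅}
    (hu : star u * u = 1) : Complex.normSq (ω u) ≤ 1 := by
  -- Positivity of the variance: for unitary `u` this value is `1 - |ω u|²`.
  have h := hω.1 (u - algebraMap ℂ 𝔅 (ω u))
  have e : star (u - algebraMap ℂ 𝔅 (ω u)) * (u - algebraMap ℂ 𝔅 (ω u)) =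
      1 - ω u • star u - star (ω u) • u + (star (ω u) * ω u) • (1 : 𝔅) := by
    rw [Algebra.algebraMap_eq_smul_one, star_sub, star_smul, star_one, sub_mul, mul_sub, mul_sub,
      hu, mul_smul_comm, mul_one, smul_mul_assoc, one_mul, smul_mul_smul_comm, one_mul]
    abel
  rw [e] at h
  simp only [map_add, map_sub, map_smul, hω.2, map_star_of_mem_stateSpace hω, smul_eq_mul] at h
  have h1 := (Complex.le_def.mp h).1
  simp [Complex.normSq_apply] at h1 ⊢
  linarith

/-- A state in the interior of a segment of states that takes the value `1` at a unitary forces the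
same value for the endpoints. -/
theorem apply_eq_one_of_mem_openSegment {ω₁ ω₂ ϑ : 𝔅 →ₗ[ℂ] ℂ} (h₁ : ω₁ ∈ stateSpace 𝔅)
    (h₂ : ω₂ ∈ stateSpace 𝔅) (h : ϑ ∈ openSegment ℝ ω₁ ω₂) {u : 𝔅} (hu : star u * u = 1)
    (hϑ : ϑ u = 1) : ω₁ u = 1 := by
  obtain ⟨a, b, ha, hb, hab, rfl⟩ := h
  have k1 := normSq_apply_le_one h₁ hu
  have k2 := normSq_apply_le_one h₂ hu
  have hre := congrArg Complex.re hϑ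
  simp only [LinearMap.add_apply, LinearMap.smul_apply, Complex.add_re, Complex.smul_re,
    smul_eq_mul, Complex.one_re, Complex.normSq_apply] at hre k1 k2
  -- Both real parts are at most `1` and a strict convex combination of them is `1`, so both equal
  -- `1`; the disc bound then leaves no room for an imaginary part.
  have l1 : (ω₁ u).re ≤ 1 := by nlinarith [mul_self_nonneg (ω₁ u).im]
  have l2 : (ω₂ u).re ≤ 1 := by nlinarith [mul_self_nonneg (ω₂ u).im]
  have e1 : (ω₁ u).re = 1 := by
    refine le_antisymm l1 ?_
    by_contra! hlt
    nlinarith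
  rw [e1] at k1
  refine Complex.ext e1 ?_
  rw [Complex.one_im]
  exact mul_self_eq_zero.mp (le_antisymm (by linarith) (mul_self_nonneg _))

/-- States that agree on a set with dense span are equal. -/
theorem eq_of_eqOn_of_dense_span {ω₁ ω₂ : 𝔅 →ₗ[ℂ] ℂ} (h₁ : ω₁ ∈ stateSpace 𝔅)
    (h₂ : ω₂ ∈ stateSpace 𝔅) {S : Set 𝔅} (hS : Dense (Submodule.span ℂ S : Set 𝔅))
    (h : Set.EqOn ω₁ ω₂ S) : ω₁ = ω₂ :=
  DFunLike.coe_injective <| Continuous.ext_on hS (continuous_of_mem_stateSpace h₁)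
    (continuous_of_mem_stateSpace h₂) (LinearMap.eqOn_span' h)

/-- A state that takes the value `1` on a set of unitaries with dense span is pure. -/
theorem mem_pureStates_of_apply_eq_one {ϑ : 𝔅 →ₗ[ℂ] ℂ} (hϑ : ϑ ∈ stateSpace 𝔅) {S : Set 𝔅}
    (hS : Dense (Submodule.span ℂ S : Set 𝔅)) (hu : ∀ u ∈ S, star u * u = 1)
    (h1 : ∀ u ∈ S, ϑ u = 1) : ϑ ∈ pureStates 𝔅 :=
  ⟨hϑ, fun _ h₁ _ h₂ hseg => eq_of_eqOn_of_dense_span h₁ hϑ hS fun u hu' =>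
    (apply_eq_one_of_mem_openSegment h₁ h₂ hseg (hu u hu') (h1 u hu')).trans (h1 u hu').symm⟩

end AbstractStates

/-- If every finite subset of `S` has a common fixed vector in some representation of a commutative
C⋆-algebra, there is a multiplicative state with value `1` on `S`. -/
theorem exists_multiplicative_state {𝔅 : Type*} [CommCStarAlgebra 𝔅] {E : Type*}
    [AddCommGroup E] [Module ℂ E] (ρ : 𝔅 →+* Module.End ℂ E) (S : Set 𝔅)
    (hS : ∀ F : Set 𝔅, F.Finite → F ⊆ S → ∃ v : E, v ≠ 0 ∧ ∀ u ∈ F, ρ u v = v) :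
    ∃ ϑ ∈ stateSpace 𝔅, (∀ u ∈ S, ϑ u = 1) ∧ ∀ a b, ϑ (a * b) = ϑ a * ϑ b := by
  -- An element of the ideal involves only finitely many generators, so it kills every vector fixed
  -- by a suitable finite part of `S`. No vector fixed by all of `S` is needed.
  have key : ∀ a ∈ Ideal.span ((fun u => u - 1) '' S), ∃ F : Set 𝔅, F.Finite ∧ F ⊆ S ∧
      ∀ v : E, (∀ u ∈ F, ρ u v = v) → ρ a v = 0 := by
    intro a ha
    induction ha using Submodule.span_induction with
    | mem a ha =>
      obtain ⟨u, hu, rfl⟩ := ha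
      refine ⟨{u}, Set.finite_singleton u, Set.singleton_subset_iff.mpr hu, fun v hv => ?_⟩
      simp [hv u rfl]
    | zero => exact ⟨∅, Set.finite_empty, Set.empty_subset _, fun v _ => by simp⟩
    | add a b _ _ iha ihb =>
      obtain ⟨F, hF, hFS, h⟩ := iha
      obtain ⟨F', hF', hFS', h'⟩ := ihb
      refine ⟨F ∪ F', hF.union hF', Set.union_subset hFS hFS', fun v hv => ?_⟩
      rw [map_add, LinearMap.add_apply, h v fun u hu => hv u (Or.inl hu),
        h' v fun u hu => hv u (Or.inr hu), add_zero]
    | smul c a _ ih =>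
      obtain ⟨F, hF, hFS, h⟩ := ih
      refine ⟨F, hF, hFS, fun v hv => ?_⟩
      rw [smul_eq_mul, map_mul, Module.End.mul_apply, h v hv, map_zero]
  have hproper : Ideal.span ((fun u => u - 1) '' S) ≠ ⊤ := by
    intro htop
    obtain ⟨F, hF, hFS, h⟩ := key 1 ((Ideal.eq_top_iff_one _).mp htop)
    obtain ⟨v, hv0, hv⟩ := hS F hF hFS
    refine hv0 ?_
    have := h v hv
    rwa [map_one, Module.End.one_apply] at this
  obtain ⟨M, hM, hle⟩ := Ideal.exists_le_maximal _ hproper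
  -- By Gelfand–Mazur the quotient by a maximal ideal is `ℂ`. The resulting character vanishes on
  -- every `u - 1`, and it is positive because characters preserve `star`.
  let φ := M.toCharacterSpace
  refine ⟨(WeakDual.CharacterSpace.toAlgHom φ).toLinearMap, ⟨fun a => ?_, map_one φ⟩,
    fun u hu => ?_, map_mul φ⟩
  · change 0 ≤ φ (star a * a)
    rw [map_mul, map_star]
    exact star_mul_self_nonneg _
  · have h := M.toCharacterSpace_apply_eq_zero_of_mem
      (hle (Ideal.subset_span ⟨u, hu, rfl⟩))
    rw [map_sub, map_one, sub_eq_zero] at h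
    exact h

/-- Existence, uniqueness, multiplicativity and purity of the state with value `1` on a set of
unitaries with dense span and with finite subsets that have common fixed vectors. -/
theorem exists_seed_state {𝔅 : Type*} [CStarAlgebra 𝔅] (hcomm : ∀ a b : 𝔅, a * b = b * a)
    (S : Set 𝔅) (hS : Dense (Submodule.span ℂ S : Set 𝔅)) (hu : ∀ u ∈ S, star u * u = 1)
    {E : Type*} [AddCommGroup E] [Module ℂ E] (ρ : 𝔅 →+* Module.End ℂ E)
    (hfix : ∀ F : Set 𝔅, F.Finite → F ⊆ S → ∃ v : E, v ≠ 0 ∧ ∀ u ∈ F, ρ u v = v) :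
    ∃ ϑ ∈ stateSpace 𝔅, (∀ u ∈ S, ϑ u = 1) ∧
      (∀ ω ∈ stateSpace 𝔅, (∀ u ∈ S, ω u = 1) → ω = ϑ) ∧
      (∀ a b, ϑ (a * b) = ϑ a * ϑ b) ∧ ϑ ∈ pureStates 𝔅 := by
  let _ : CommCStarAlgebra 𝔅 := { ‹CStarAlgebra 𝔅› with mul_comm := hcomm }
  obtain ⟨ϑ, hϑ, h1, hmul⟩ := exists_multiplicative_state ρ S hfix
  exact ⟨ϑ, hϑ, h1, fun ω hω hω1 => eq_of_eqOn_of_dense_span hω hϑ hS fun u hu' =>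
    (hω1 u hu').trans (h1 u hu').symm, hmul, mem_pureStates_of_apply_eq_one hϑ hS hu h1⟩

/-- Closedness at both levels makes `R` a C⋆-algebra; the representation in which fixed vectors are
sought is its defining action on `E`. -/
theorem exists_seed_state_of_starSubalgebra {E : Type*} [NormedAddCommGroup E]
    [InnerProductSpace ℂ E] [CompleteSpace E]
    (Q : StarSubalgebra ℂ (E →L[ℂ] E)) (hQ : IsClosed (Q : Set (E →L[ℂ] E)))
    (R : StarSubalgebra ℂ Q) (hR : IsClosed (R : Set Q)) (hcomm : ∀ a b : R, a * b = b * a)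
    (S : Set R) (hS : Dense (Submodule.span ℂ S : Set R)) (hu : ∀ u ∈ S, star u * u = 1)
    (hfix : ∀ F : Set R, F.Finite → F ⊆ S → ∃ v : E, v ≠ 0 ∧ ∀ u ∈ F, u.1.1 v = v) :
    ∃ ϑ ∈ stateSpace R, (∀ u ∈ S, ϑ u = 1) ∧
      (∀ ω ∈ stateSpace R, (∀ u ∈ S, ω u = 1) → ω = ϑ) ∧
      (∀ a b, ϑ (a * b) = ϑ a * ϑ b) ∧ ϑ ∈ pureStates R := by
  have := hQ
  let _ : CStarAlgebra Q := StarSubalgebra.cstarAlgebra Q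
  have := hR
  let _ : CStarAlgebra R := StarSubalgebra.cstarAlgebra R
  let ρ : R →+* Module.End ℂ E := ContinuousLinearMap.toLinearMapRingHom.comp
    (Q.subtype.toRingHom.comp R.subtype.toRingHom)
  exact exists_seed_state hcomm S hS hu ρ hfix

/-! ### The annihilation of `δ^{-1} t` by `δ_1 γ`. -/

section Orthogonality

variable {V : Type u} [LinearOrder V] {K : GeometricData V}

theorem Simplex.dim_mem {n : ℤ} (x : Simplex K n) : 0 ≤ n ∧ n ≤ K.dim := by
  have h1 := K.card_le x.1 x.2.1
  have h2 := x.2.2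
  have h3 := (K.complex.isRelLowerSet_faces x.2.1).1.card_pos
  omega

variable {𝔾 : ChainComplex AddCommGrpCat.{w} ℤ}

/-- The pairing of a dual `0`-map with a `0`-map is the sum of the pairings in all dimensions. -/
theorem ofMul_charValue (β : DualPMap₀ K 𝔾 0) (s : PMap₀ K 𝔾 0) :
    Additive.ofMul (charValue (fun x => toDualConf β x) (toConf s)) =
      ∑ n ∈ Finset.range (K.dim + 1),
        pairing (β.1 ⟨n, n, sub_self _⟩) (s.1 ⟨n, n, sub_self _⟩) := by
  have hs : ∀ n : ℤ, (suppHom (s.1 ⟨n, n, sub_self n⟩)).Finite := fun n => s.2 _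
  -- Natural-number dimensions suffice, since simplices are nonempty and have dimension at most
  -- `K.dim`.
  let T : Finset (Site K) := ((Finset.range (K.dim + 1)).map Nat.castEmbedding).sigma
    fun n => (hs n).toFinset
  rw [charValue, finprod_eq_prod_of_mulSupport_subset (s := T), ofMul_prod, Finset.sum_sigma,
    Finset.sum_map]
  · refine Finset.sum_congr rfl fun n _ => ?_
    rw [pairing_eq_sum _ _ (hs n).toFinset (by simp)]
    refine Finset.sum_congr rfl fun x _ => ?_
    rw [toConf_apply, toDualConf_apply]
    rfl
  · rintro ⟨n, x⟩ hx
    have hn := x.dim_mem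
    lift n to ℕ using hn.1
    simp only [T, Finset.coe_sigma, Set.mem_sigma_iff, Set.Finite.coe_toFinset, Finset.mem_coe,
      Finset.mem_map, Finset.mem_range, Nat.castEmbedding_apply]
    refine ⟨⟨n, by omega, rfl⟩, fun h => hx ?_⟩
    beta_reduce
    rw [toConf_apply, h, AddChar.map_zero_eq_one]

/-- The pairing of `γ_n` with `∂ ∘ t_{n-1} ∘ ∂`, where `m = n - 1`. -/
def mixedPairing (t : PMap K 𝔾 (-1)) (γ : DualPMap K 𝔾 1) (n m : ℤ) (h : n = m + 1) :
    Additive Circle :=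
  pairing (γ ⟨n, m, by omega⟩)
    (((𝔾.d n m).hom.comp (t ⟨m, n, by omega⟩)).comp (chainBoundary K n m))

theorem pairing_dualBoundary_comp {n i j : ℤ} (f : Chain K n →+ AddChar (𝔾.X i) Circle)
    (t : Chain K n →+ 𝔾.X j) :
    pairing ((dualBoundary 𝔾 i j).comp f) t = pairing f ((𝔾.d j i).hom.comp t) := rfl

theorem suppHom_comp_left {A A' : Type*} [AddCommGroup A] [AddCommGroup A'] {n : ℤ}
    (e : A →+ A') {t : Chain K n →+ A} (ht : (suppHom t).Finite) :
    (suppHom (e.comp t)).Finite :=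
  ht.subset fun x hx h => hx (by rw [AddMonoidHom.comp_apply, h, map_zero])

/-- In these degrees the sign conventions turn `δ^{-1}` into a sum and `δ_1` into a difference.
Moving the dual operators across the pairing gives four terms: `z1` contains the simplicial boundary
twice, `z2` the boundary of `𝔾` twice, and the remaining two are the mixed pairings. -/
theorem pairing_deltaDual_delta (t : PMap₀ K 𝔾 (-1)) (γ : DualPMap₀ K 𝔾 1) (n : ℤ) :
    pairing ((deltaDual₀ 1 0 (by norm_num) γ).1 ⟨n, n, sub_self n⟩)
        ((delta₀ (-1) 0 (by norm_num) t).1 ⟨n, n, sub_self n⟩) =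
      mixedPairing t.1 γ.1 (n + 1) n rfl - mixedPairing t.1 γ.1 n (n - 1) (by ring) := by
  have ht1 := t.2 ⟨n - 1, n, by ring⟩
  have ht2 := t.2 ⟨n, n + 1, by ring⟩
  have e1 : (deltaDual₀ 1 0 (by norm_num) γ).1 ⟨n, n, sub_self n⟩ =
      (γ.1 ⟨n + 1, n, by ring⟩).comp (chainCoboundary K n (n + 1)) -
        (dualBoundary 𝔾 (n - 1) n).comp (γ.1 ⟨n, n - 1, by ring⟩) := by
    refine congrArg₂ (· - ·) rfl ?_
    simp
  have e2 : (delta₀ (-1) 0 (by norm_num) t).1 ⟨n, n, sub_self n⟩ =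
      (t.1 ⟨n - 1, n, by ring⟩).comp (chainBoundary K n (n - 1)) +
        (𝔾.d (n + 1) n).hom.comp (t.1 ⟨n, n + 1, by ring⟩) := by
    refine (congrArg₂ (· - ·) rfl ?_).trans (sub_neg_eq_add _ _)
    simp
  have f1 := suppHom_comp_chainBoundary (n := n) ht1
  have f2 := suppHom_comp_left (𝔾.d (n + 1) n).hom ht2
  have z1 : pairing ((γ.1 ⟨n + 1, n, by ring⟩).comp (chainCoboundary K n (n + 1)))
      ((t.1 ⟨n - 1, n, by ring⟩).comp (chainBoundary K n (n - 1))) = 0 := by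
    rw [pairing_comp_chainCoboundary _ f1, AddMonoidHom.comp_assoc,
      chainBoundary_chainBoundary rfl, AddMonoidHom.comp_zero, pairing_zero_right]
  have z2 : pairing ((dualBoundary 𝔾 (n - 1) n).comp (γ.1 ⟨n, n - 1, by ring⟩))
      ((𝔾.d (n + 1) n).hom.comp (t.1 ⟨n, n + 1, by ring⟩)) = 0 := by
    rw [pairing_dualBoundary_comp, ← AddMonoidHom.comp_assoc, ← AddCommGrpCat.hom_comp,
      𝔾.d_comp_d, AddCommGrpCat.hom_zero, AddMonoidHom.zero_comp, pairing_zero_right]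
  rw [e1, e2, pairing_add_right _ f1 f2, pairing_sub_left _ _ f1, pairing_sub_left _ _ f2, z1, z2,
    pairing_comp_chainCoboundary _ f2, pairing_dualBoundary_comp]
  rw [zero_sub, sub_zero, neg_add_eq_sub]
  rfl

theorem mixedPairing_congr (t : PMap K 𝔾 (-1)) (γ : DualPMap K 𝔾 1) {n m n' m' : ℤ}
    (h : n = m + 1) (hn : n = n') (hm : m = m') :
    mixedPairing t γ n m h = mixedPairing t γ n' m' (by omega) := by
  subst hn hm
  rfl

/-- A nonzero term needs both an `n`-simplex and an `(n-1)`-simplex. This is why already `n = 0`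
gives zero. -/
theorem mixedPairing_eq_zero (t : PMap K 𝔾 (-1)) (γ : DualPMap K 𝔾 1) {n m : ℤ} (h : n = m + 1)
    (hn : n ≤ 0 ∨ K.dim < n) : mixedPairing t γ n m h = 0 := by
  rw [mixedPairing, pairing_eq_sum _ _ ∅, Finset.sum_empty]
  intro x hx
  obtain ⟨y, -, -⟩ := exists_of_apply_ne_zero ((𝔾.d n m).hom.comp (t ⟨m, n, by omega⟩)) hx
  have h1 : 0 ≤ n ∧ n ≤ K.dim := x.dim_mem
  have h2 : 0 ≤ m ∧ m ≤ K.dim := y.dim_mem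
  omega

/-- `δ_1 γ` annihilates `δ^{-1} t`. -/
theorem charValue_deltaDual_delta (t : PMap₀ K 𝔾 (-1)) (γ : DualPMap₀ K 𝔾 1) :
    charValue (fun x => toDualConf (deltaDual₀ 1 0 (by norm_num) γ) x)
      (toConf (delta₀ (-1) 0 (by norm_num) t)) = 1 := by
  refine Additive.ofMul.injective ?_
  rw [ofMul_charValue, ofMul_one]
  -- The telescoping sum runs from index `0` to `K.dim + 1`, exactly the two indices at which the
  -- mixed pairing vanishes.
  have key := Finset.sum_range_sub
    (fun k : ℕ => mixedPairing t.1 γ.1 (k : ℤ) (k - 1) (by ring)) (K.dim + 1)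
  rw [mixedPairing_eq_zero _ _ _ (Or.inr (by push_cast; omega)),
    mixedPairing_eq_zero _ _ _ (Or.inl (by simp)), sub_zero] at key
  rw [← key]
  refine Finset.sum_congr rfl fun k _ => ?_
  rw [← mixedPairing_congr t.1 γ.1 (n := (k : ℤ) + 1) rfl (by push_cast; rfl)
    (by push_cast; ring : (k : ℤ) = ((k + 1 : ℕ) : ℤ) - 1)]
  exact pairing_deltaDual_delta t γ k

end Orthogonality

/-! ### Shift and clock operators: commutation and common fixed vectors. -/

section Operators

variable {ι : Type u} {G : ι → Type w} [∀ i, AddCommGroup (G i)]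

theorem finite_mulSupport_charValue (α : ∀ i, AddChar (G i) Circle) (h : Conf G) :
    (Function.mulSupport fun i => α i (h i)).Finite := by
  classical
  refine h.support.finite_toSet.subset fun i hi => ?_
  rw [Finset.mem_coe, DFinsupp.mem_support_iff]
  intro h0
  exact hi (by beta_reduce; rw [h0, AddChar.map_zero_eq_one])

theorem charValue_add (α : ∀ i, AddChar (G i) Circle) (h k : Conf G) :
    charValue α (h + k) = charValue α h * charValue α k := by
  rw [charValue, charValue, charValue,
    ← finprod_mul_distrib (finite_mulSupport_charValue α h) (finite_mulSupport_charValue α k)]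
  exact finprod_congr fun i => AddChar.map_add_eq_mul _ _ _

theorem charValue_dual_add (α β : Π₀ i, AddChar (G i) Circle) (h : Conf G) :
    charValue (fun i => (α + β) i) h =
      charValue (fun i => α i) h * charValue (fun i => β i) h := by
  rw [charValue, charValue, charValue,
    ← finprod_mul_distrib (finite_mulSupport_charValue _ h) (finite_mulSupport_charValue _ h)]
  rfl

theorem charValue_dual_zero (h : Conf G) :
    charValue (fun i => (0 : Π₀ i, AddChar (G i) Circle) i) h = 1 := by
  rw [charValue]
  simp

theorem clockOp_apply (α : Π₀ i, AddChar (G i) Circle) (v : ConfSpace G) (h : Conf G) :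
    clockOp α v h = charValue (fun i => α i) h * v h := rfl

theorem shiftOp_zero : shiftOp (0 : Conf G) = 1 :=
  ConfSpace.ext_op fun v h => by simp

theorem shiftOp_add (g g' : Conf G) : shiftOp (g + g') = shiftOp g * shiftOp g' :=
  ConfSpace.ext_op fun v h => by
    rw [mul_op_apply, shiftOp_apply, shiftOp_apply, shiftOp_apply, sub_sub]

theorem clockOp_zero : clockOp (0 : Π₀ i, AddChar (G i) Circle) = 1 :=
  ConfSpace.ext_op fun v h => by
    rw [clockOp_apply, charValue_dual_zero, Circle.coe_one, one_mul]
    rfl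

theorem clockOp_add (α β : Π₀ i, AddChar (G i) Circle) :
    clockOp (α + β) = clockOp α * clockOp β :=
  ConfSpace.ext_op fun v h => by
    rw [mul_op_apply, clockOp_apply, clockOp_apply, clockOp_apply, charValue_dual_add,
      Circle.coe_mul, mul_assoc]

theorem star_clockOp (α : Π₀ i, AddChar (G i) Circle) : star (clockOp α) = clockOp (-α) := by
  rw [clockOp, star_mulOp]
  refine ConfSpace.ext_op fun v h => ?_
  have e : charValue (fun i => (-α) i) h = (charValue (fun i => α i) h)⁻¹ := by
    have h0 : -α + α = 0 := neg_add_cancel α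
    rw [eq_inv_iff_mul_eq_one, ← charValue_dual_add, h0, charValue_dual_zero]
  rw [clockOp_apply, mulOp_apply, e, Circle.coe_inv_eq_conj]
  rfl

/-- Weyl relation: exchanging the two operators costs the phase `α(g)`, assumed trivial here. -/
theorem shiftOp_mul_clockOp (g : Conf G) (α : Π₀ i, AddChar (G i) Circle)
    (h : charValue (fun i => α i) g = 1) : shiftOp g * clockOp α = clockOp α * shiftOp g :=
  ConfSpace.ext_op fun v k => by
    have e : charValue (fun i => α i) k = charValue (fun i => α i) (k - g) := by
      conv_lhs => rw [← sub_add_cancel k g, charValue_add, h, mul_one]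
    rw [mul_op_apply, mul_op_apply, shiftOp_apply, clockOp_apply, clockOp_apply, shiftOp_apply, e]

/-- The sum of the basis vectors `|h⟩`, `h ∈ s`. -/
def indicatorVec (s : Set (Conf G)) (hs : s.Finite) : ConfSpace G :=
  ⟨s.indicator fun _ => 1, by
    refine memℓp_gen (summable_of_hasFiniteSupport (hs.subset fun h hh => ?_))
    by_contra H
    simp [H] at hh⟩

theorem indicatorVec_apply (s : Set (Conf G)) (hs : s.Finite) (h : Conf G) :
    indicatorVec s hs h = s.indicator (fun _ => 1) h := rfl

theorem shiftOp_indicatorVec (H : AddSubgroup (Conf G)) (hH : (H : Set (Conf G)).Finite)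
    {g : Conf G} (hg : g ∈ H) : shiftOp g (indicatorVec H hH) = indicatorVec H hH := by
  refine lp.ext (funext fun h => ?_)
  rw [shiftOp_apply, indicatorVec_apply, indicatorVec_apply]
  have : h - g ∈ (H : Set (Conf G)) ↔ h ∈ (H : Set (Conf G)) :=
    ⟨fun h' => by simpa using H.add_mem h' hg, fun h' => H.sub_mem h' hg⟩
  by_cases hh : h ∈ (H : Set (Conf G))
  · rw [Set.indicator_of_mem hh, Set.indicator_of_mem (this.mpr hh)]
  · rw [Set.indicator_of_notMem hh, Set.indicator_of_notMem (mt this.mp hh)]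

theorem clockOp_indicatorVec (s : Set (Conf G)) (hs : s.Finite) (α : Π₀ i, AddChar (G i) Circle)
    (hα : ∀ h ∈ s, charValue (fun i => α i) h = 1) :
    clockOp α (indicatorVec s hs) = indicatorVec s hs := by
  refine lp.ext (funext fun h => ?_)
  rw [clockOp_apply, indicatorVec_apply]
  by_cases hh : h ∈ s
  · rw [hα h hh, Circle.coe_one, one_mul]
  · rw [Set.indicator_of_notMem hh, mul_zero]

theorem indicatorVec_ne_zero {s : Set (Conf G)} (hs : s.Finite) {h : Conf G} (hh : h ∈ s) :
    indicatorVec s hs ≠ 0 := by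
  intro H
  have h1 : indicatorVec s hs h = 0 := by rw [H]; rfl
  rw [indicatorVec_apply, Set.indicator_of_mem hh] at h1
  exact one_ne_zero h1

/-- The configurations that vanish outside `Λ`. -/
def confOn (G : ι → Type w) [∀ i, AddCommGroup (G i)] (Λ : Finset ι) : AddSubgroup (Conf G) where
  carrier := {h | ∀ i ∉ Λ, h i = 0}
  zero_mem' _ _ := rfl
  add_mem' h1 h2 i hi := by rw [DFinsupp.add_apply, h1 i hi, h2 i hi, add_zero]
  neg_mem' h1 i hi := by rw [DFinsupp.neg_apply, h1 i hi, neg_zero]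

theorem finite_confOn [∀ i, Finite (G i)] (Λ : Finset ι) : (confOn G Λ : Set (Conf G)).Finite := by
  refine (Set.finite_range (ext0 (G := G) Λ)).subset fun h hh => ⟨res Λ h, ?_⟩
  ext i
  by_cases hi : i ∈ Λ
  · rw [ext0_of_mem _ hi]; rfl
  · rw [ext0_of_notMem _ hi, hh i hi]

/-- Finitely many shifts by elements of a subgroup `D` of configurations and all the clock operators
that are trivial on `D` have a common fixed vector. -/
theorem exists_fixed_vector [∀ i, Finite (G i)] (D : AddSubgroup (Conf G)) (F : Set (Conf G))
    (hF : F.Finite) (hFD : F ⊆ D) :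
    ∃ v : ConfSpace G, v ≠ 0 ∧ (∀ g ∈ F, shiftOp g v = v) ∧
      ∀ α : Π₀ i, AddChar (G i) Circle, (∀ h ∈ D, charValue (fun i => α i) h = 1) →
        clockOp α v = v := by
  classical
  -- `D` may be infinite, and then the sum over it is not square summable. Cutting down to
  -- configurations on `Λ` gives a finite subgroup that still contains `F`.
  let Λ : Finset ι := hF.toFinset.biUnion DFinsupp.support
  have hfin : ((D ⊓ confOn G Λ : AddSubgroup (Conf G)) : Set (Conf G)).Finite :=
    (finite_confOn Λ).subset fun h hh => hh.2
  refine ⟨indicatorVec _ hfin, indicatorVec_ne_zero hfin (zero_mem (D ⊓ confOn G Λ)),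
    fun g hg => shiftOp_indicatorVec _ hfin ⟨hFD hg, fun i hi => ?_⟩,
    fun α hα => clockOp_indicatorVec _ hfin α fun h hh => hα h hh.1⟩
  by_contra h0
  exact hi (Finset.mem_biUnion.mpr ⟨g, hF.mem_toFinset.mpr hg, DFinsupp.mem_support_iff.mpr h0⟩)

end Operators
-- Reduces density inside the closed subalgebra to a purely algebraic spanning statement about `R`
-- in the ambient algebra.
theorem dense_span_topologicalClosure {𝔄 : Type*} [TopologicalSpace 𝔄] [Ring 𝔄] [StarRing 𝔄]
    [Algebra ℂ 𝔄] [StarModule ℂ 𝔄] [IsTopologicalRing 𝔄] [ContinuousStar 𝔄]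
    (R : StarSubalgebra ℂ 𝔄) (S : Set R.topologicalClosure)
    (h : ∀ a ∈ R, a ∈ Submodule.span ℂ (Subtype.val '' S)) :
    Dense (Submodule.span ℂ S : Set R.topologicalClosure) := by
  intro a
  rw [closure_subtype]
  refine closure_mono (fun b hb => ?_) a.2
  have hb' := h b hb
  rw [show (Subtype.val '' S : Set 𝔄) = R.topologicalClosure.subtype.toLinearMap '' S from rfl,
    ← Submodule.map_span] at hb'
  exact hb'

theorem isClosed_quasiLocal {ι : Type u} (G : ι → Type w) [∀ i, AddCommGroup (G i)]
    [∀ i, Finite (G i)] : IsClosed (quasiLocal G : Set (ConfSpace G →L[ℂ] ConfSpace G)) :=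
  StarSubalgebra.isClosed_topologicalClosure _

/-! ### The core algebra and its group of stabilizers. -/

section CoreAlgebra

variable {V : Type u} [LinearOrder V] {K : GeometricData V}
  {𝔾 : ChainComplex AddCommGrpCat.{w} ℤ}

theorem delta_add (p q : ℤ) (hpq : p + 1 = q) (s t : PMap K 𝔾 p) :
    delta p q hpq (s + t) = delta p q hpq s + delta p q hpq t := by
  funext i
  simp only [delta, Pi.add_apply, AddMonoidHom.add_comp, AddMonoidHom.comp_add, smul_add]
  abel

theorem deltaDual_add (p q : ℤ) (hpq : q + 1 = p) (γ η : DualPMap K 𝔾 p) :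
    deltaDual p q hpq (γ + η) = deltaDual p q hpq γ + deltaDual p q hpq η := by
  funext i
  simp only [deltaDual, Pi.add_apply, AddMonoidHom.add_comp, AddMonoidHom.comp_add, smul_add]
  abel

/-- The configuration by which `A_t` shifts. -/
def shiftConf : PMap₀ K 𝔾 (-1) →+ Conf (SiteGroup K 𝔾) :=
  AddMonoidHom.mk' (fun t => toConf (delta₀ (-1) 0 (by norm_num) t)) fun s t => by
    ext x
    rw [DFinsupp.add_apply, toConf_apply, toConf_apply, toConf_apply]
    simp only [delta₀, AddSubgroup.coe_add, delta_add, Pi.add_apply, AddMonoidHom.add_apply]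

/-- The family of characters that `B_γ` multiplies with. -/
def clockConf : DualPMap₀ K 𝔾 1 →+ Π₀ x : Site K, AddChar (SiteGroup K 𝔾 x) Circle :=
  AddMonoidHom.mk' (fun γ => toDualConf (deltaDual₀ 1 0 (by norm_num) γ)) fun γ η => by
    refine DFinsupp.ext fun x => ?_
    rw [DFinsupp.add_apply, toDualConf_apply, toDualConf_apply, toDualConf_apply]
    simp only [deltaDual₀, AddSubgroup.coe_add, deltaDual_add, Pi.add_apply,
      AddMonoidHom.add_apply]

theorem charValue_clockConf_shiftConf (t : PMap₀ K 𝔾 (-1)) (γ : DualPMap₀ K 𝔾 1) :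
    charValue (fun x => clockConf γ x) (shiftConf t) = 1 :=
  charValue_deltaDual_delta t γ

variable [∀ j, Finite (𝔾.X j)]

theorem coe_A (t : PMap₀ K 𝔾 (-1)) : (A t).1 = shiftOp (shiftConf t) := rfl

theorem coe_B (γ : DualPMap₀ K 𝔾 1) : (B γ).1 = clockOp (clockConf γ) := rfl

theorem A_zero : A (0 : PMap₀ K 𝔾 (-1)) = 1 :=
  Subtype.ext (by rw [coe_A, map_zero, shiftOp_zero]; rfl)

theorem B_zero : B (0 : DualPMap₀ K 𝔾 1) = 1 :=
  Subtype.ext (by rw [coe_B, map_zero, clockOp_zero]; rfl)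

theorem A_add (s t : PMap₀ K 𝔾 (-1)) : A (s + t) = A s * A t :=
  Subtype.ext (by rw [coe_A, map_add, shiftOp_add]; rfl)

theorem B_add (γ η : DualPMap₀ K 𝔾 1) : B (γ + η) = B γ * B η :=
  Subtype.ext (by rw [coe_B, map_add, clockOp_add]; rfl)

theorem star_A (t : PMap₀ K 𝔾 (-1)) : star (A t) = A (-t) :=
  Subtype.ext (by rw [coe_A, map_neg, ← star_shiftOp]; rfl)

theorem star_B (γ : DualPMap₀ K 𝔾 1) : star (B γ) = B (-γ) :=
  Subtype.ext (by rw [coe_B, map_neg, ← star_clockOp]; rfl)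

theorem A_mul_B (t : PMap₀ K 𝔾 (-1)) (γ : DualPMap₀ K 𝔾 1) : A t * B γ = B γ * A t :=
  Subtype.ext (shiftOp_mul_clockOp _ _ (charValue_clockConf_shiftConf t γ))

theorem A_mul_A (s t : PMap₀ K 𝔾 (-1)) : A s * A t = A t * A s := by
  rw [← A_add, add_comm, A_add]

theorem B_mul_B (γ η : DualPMap₀ K 𝔾 1) : B γ * B η = B η * B γ := by
  rw [← B_add, add_comm, B_add]

theorem AB_mul_AB (s t : PMap₀ K 𝔾 (-1)) (γ η : DualPMap₀ K 𝔾 1) :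
    A s * B γ * (A t * B η) = A (s + t) * B (γ + η) := by
  rw [A_add, B_add, mul_assoc, ← mul_assoc (B γ), ← A_mul_B t γ]
  simp only [mul_assoc]

theorem star_AB (t : PMap₀ K 𝔾 (-1)) (γ : DualPMap₀ K 𝔾 1) :
    star (A t * B γ) = A (-t) * B (-γ) := by
  rw [star_mul, star_A, star_B, A_mul_B]

theorem isClosed_core : IsClosed (core K 𝔾 : Set (quasiLocal (SiteGroup K 𝔾))) :=
  StarSubalgebra.isClosed_topologicalClosure _

theorem core_mul_comm (a b : core K 𝔾) : a * b = b * a := by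
  have h : ∀ x ∈ Set.range (A (K := K) (𝔾 := 𝔾)) ∪ Set.range B,
      ∀ y ∈ Set.range (A (K := K) (𝔾 := 𝔾)) ∪ Set.range B, x * y = y * x := by
    rintro _ (⟨s, rfl⟩ | ⟨γ, rfl⟩) _ (⟨t, rfl⟩ | ⟨η, rfl⟩)
    · exact A_mul_A s t
    · exact A_mul_B s η
    · exact (A_mul_B t γ).symm
    · exact B_mul_B γ η
  -- A generated star algebra is commutative only if the generators also commute with each other's
  -- adjoints; here the adjoints are again generators. Continuity of multiplication carries
  -- commutativity to the closure.
  have hstar : ∀ y ∈ Set.range (A (K := K) (𝔾 := 𝔾)) ∪ Set.range B,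
      star y ∈ Set.range (A (K := K) (𝔾 := 𝔾)) ∪ Set.range B := by
    rintro _ (⟨t, rfl⟩ | ⟨η, rfl⟩)
    · exact Or.inl ⟨-t, (star_A t).symm⟩
    · exact Or.inr ⟨-η, (star_B η).symm⟩
  have hc := StarAlgebra.isMulCommutative_adjoin ℂ h fun x hx y hy => h x hx _ (hstar y hy)
  exact (StarSubalgebra.commRingTopologicalClosure _ fun x y => hc.is_comm.comm x y).mul_comm a b

/-- The products `A_t B_γ` in the core algebra. -/
def stabilizers (K : GeometricData V) (𝔾 : ChainComplex AddCommGrpCat.{w} ℤ)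
    [∀ j, Finite (𝔾.X j)] : Set (core K 𝔾) :=
  Set.range fun p : PMap₀ K 𝔾 (-1) × DualPMap₀ K 𝔾 1 => coreA p.1 * coreB p.2

theorem mem_stabilizers (t : PMap₀ K 𝔾 (-1)) (γ : DualPMap₀ K 𝔾 1) :
    coreA t * coreB γ ∈ stabilizers K 𝔾 :=
  Set.mem_range_self (t, γ)

theorem forall_mem_stabilizers {p : core K 𝔾 → Prop} (h : ∀ t γ, p (coreA t * coreB γ)) :
    ∀ u ∈ stabilizers K 𝔾, p u :=
  Set.forall_mem_range.mpr fun q => h q.1 q.2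

theorem star_mul_self_of_mem_stabilizers {u : core K 𝔾} (hu : u ∈ stabilizers K 𝔾) :
    star u * u = 1 := by
  obtain ⟨⟨t, γ⟩, rfl⟩ := hu
  refine Subtype.ext ?_
  change star (A t * B γ) * (A t * B γ) = 1
  rw [star_AB, AB_mul_AB, neg_add_cancel, neg_add_cancel, A_zero, B_zero, one_mul]

/-- The products `A t * B γ` contain `1` and all generators and are closed under multiplication and
`star`, so their span is already a star subalgebra. -/
theorem mem_span_of_mem_adjoin {a : quasiLocal (SiteGroup K 𝔾)}
    (ha : a ∈ StarAlgebra.adjoin ℂ (Set.range (A (K := K) (𝔾 := 𝔾)) ∪ Set.range B)) :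
    a ∈ Submodule.span ℂ
      (Set.range fun p : PMap₀ K 𝔾 (-1) × DualPMap₀ K 𝔾 1 => A p.1 * B p.2) := by
  induction ha using StarAlgebra.adjoin_induction with
  | mem x hx =>
    refine Submodule.subset_span ?_
    rcases hx with ⟨t, rfl⟩ | ⟨γ, rfl⟩
    · exact ⟨(t, 0), by simp only [B_zero, mul_one]⟩
    · exact ⟨(0, γ), by simp only [A_zero, one_mul]⟩
  | algebraMap c =>
    rw [Algebra.algebraMap_eq_smul_one]
    refine Submodule.smul_mem _ _ (Submodule.subset_span ⟨(0, 0), ?_⟩)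
    simp only [A_zero, B_zero, one_mul]
  | add x y _ _ hx hy => exact add_mem hx hy
  | mul x y _ _ hx hy =>
    have h := Submodule.mul_mem_mul hx hy
    rw [Submodule.span_mul_span] at h
    refine Submodule.span_mono ?_ h
    rintro _ ⟨_, ⟨p, rfl⟩, _, ⟨q, rfl⟩, rfl⟩
    exact ⟨p + q, (AB_mul_AB _ _ _ _).symm⟩
  | star x hmem hx =>
    clear hmem
    induction hx using Submodule.span_induction with
    | mem y hy =>
      obtain ⟨p, rfl⟩ := hy
      exact Submodule.subset_span ⟨-p, (star_AB _ _).symm⟩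
    | zero => rw [star_zero]; exact zero_mem _
    | add y z _ _ hy hz => rw [star_add]; exact add_mem hy hz
    | smul c y _ hy => rw [star_smul]; exact Submodule.smul_mem _ _ hy

theorem dense_span_stabilizers : Dense (Submodule.span ℂ (stabilizers K 𝔾) : Set (core K 𝔾)) := by
  refine dense_span_topologicalClosure _ _ fun b hb => ?_
  refine Submodule.span_mono ?_ (mem_span_of_mem_adjoin hb)
  rintro _ ⟨p, rfl⟩
  exact ⟨_, ⟨p, rfl⟩, rfl⟩

theorem exists_common_fixed_vector (F : Set (core K 𝔾)) (hF : F.Finite)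
    (hFS : F ⊆ stabilizers K 𝔾) :
    ∃ v : ConfSpace (SiteGroup K 𝔾), v ≠ 0 ∧ ∀ u ∈ F, u.1.1 v = v := by
  choose p hp using fun u : F => hFS u.2
  have := hF.to_subtype
  -- With `D` the group of all configurations `δ^{-1} t`, the duality makes every clock `B_γ`
  -- trivial on `D`; only the finitely many shifts occurring in `F` restrict the region.
  obtain ⟨v, hv0, hv, hv'⟩ := exists_fixed_vector (shiftConf (K := K) (𝔾 := 𝔾)).range
    (Set.range fun u => shiftConf (p u).1) (Set.finite_range _) (by
      rintro _ ⟨u, rfl⟩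
      exact ⟨_, rfl⟩)
  refine ⟨v, hv0, fun u hu => ?_⟩
  have hpu : coreA (p ⟨u, hu⟩).1 * coreB (p ⟨u, hu⟩).2 = u := hp ⟨u, hu⟩
  have hclock := hv' (clockConf (p ⟨u, hu⟩).2) (by
    rintro _ ⟨t, rfl⟩
    exact charValue_clockConf_shiftConf t _)
  have hu1 : u.1.1 = shiftOp (shiftConf (p ⟨u, hu⟩).1) * clockOp (clockConf (p ⟨u, hu⟩).2) :=
    congrArg (fun a : core K 𝔾 => a.1.1) hpu.symm
  rw [hu1, mul_apply_eq_comp, hclock, hv _ ⟨⟨u, hu⟩, rfl⟩]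

end CoreAlgebra

end HigherQDM

theorem mainTheorem8 {V : Type u} [LinearOrder V] (K : HigherQDM.GeometricData V)
    (𝔾 : ChainComplex AddCommGrpCat.{w} ℤ) [∀ j, Finite (𝔾.X j)]
    (h𝔾 : ∀ j : ℤ, j < 0 ∨ (K.dim : ℤ) < j → Subsingleton (𝔾.X j)) :
    (∀ a b : HigherQDM.core K 𝔾, a * b = b * a) ∧
    ∃ ϑ ∈ HigherQDM.stateSpace (HigherQDM.core K 𝔾),
      (∀ (t : HigherQDM.PMap₀ K 𝔾 (-1)) (γ : HigherQDM.DualPMap₀ K 𝔾 1),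
        ϑ (HigherQDM.coreA t * HigherQDM.coreB γ) = 1) ∧
      (∀ ω ∈ HigherQDM.stateSpace (HigherQDM.core K 𝔾),
        (∀ (t : HigherQDM.PMap₀ K 𝔾 (-1)) (γ : HigherQDM.DualPMap₀ K 𝔾 1),
          ω (HigherQDM.coreA t * HigherQDM.coreB γ) = 1) → ω = ϑ) ∧
      (∀ a b : HigherQDM.core K 𝔾, ϑ (a * b) = ϑ a * ϑ b) ∧
      ϑ ∈ HigherQDM.pureStates (HigherQDM.core K 𝔾) := by
  have hseed := HigherQDM.exists_seed_state_of_starSubalgebra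
    (HigherQDM.quasiLocal (HigherQDM.SiteGroup K 𝔾)) (HigherQDM.isClosed_quasiLocal _)
    (HigherQDM.core K 𝔾) HigherQDM.isClosed_core HigherQDM.core_mul_comm
    (HigherQDM.stabilizers K 𝔾) HigherQDM.dense_span_stabilizers
    (fun _ hu => HigherQDM.star_mul_self_of_mem_stabilizers hu)
    HigherQDM.exists_common_fixed_vector
  obtain ⟨ϑ, hϑ, h1, huniq, hmul, hpure⟩ := hseed
  exact ⟨HigherQDM.core_mul_comm, ϑ, hϑ, fun t γ => h1 _ (HigherQDM.mem_stabilizers t γ),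
    fun ω hω hω1 => huniq ω hω (HigherQDM.forall_mem_stabilizers hω1), hmul, hpure⟩

end
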